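/- Let $1\le r<\infty$ and let $E$ be a (real) Banach lattice. In a Banach lattice, $(\sum_{k=1}^n|x_k|^r)^{1/r}$ denotes the element $\sup\{\sum_{k=1}^n a_kx_k : a\in\mathbb R^n,\ \|a\|_{\ell_{r'}^n}\le 1\}$, $\frac1r+\frac1{r'}=1$ (the supremum exists and agrees with the element given by Krivine's functional calculus). The following are equivalent: (1) $E$ is $r$-convex: there is $c\ge 0$ such that $\|(\sum_{k=1}^n|x_k|^r)^{1/r}\|_E\le c\,(\sum_{k=1}^n\|x_k\|_E^r)^{1/r}$ for all $n$ and all $x_1,\dots,x_n\in E$. (2) Every positive (bounded, linear) operator $T:E\to Y$ into an arbitrary Banach lattice $Y$ is $r$-convex: there is $c\ge 0$ such that $\|(\sum_{k=1}^n|Tx_k|^r)^{1/r}\|_Y\le c\,(\sum_{k=1}^n\|x_k\|_E^r)^{1/r}$ for all $n$ and all $x_1,\dots,x_n\in E$. (3) For every $\sigma$-finite complete measure space $(\Omega,\Sigma,\nu)$, every $r$-concave Banach function space $Y(\nu)$ and every positive (bounded, linear) operator $T:E\to Y(\nu)$ there is a weight $0\le\omega\in L_0(\nu)$ with $\sup_{\|y\|_{L_r(\nu)}\le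 1}\|\omega^{1/r}y\|_Y<\infty$ such that $$\Bigl(\int\frac{|Tx|^r}{\omega}\,d\nu\Bigr)^{1/r}\le\|x\|_E\qquad\text{for all }x\in E$$ (the integrand is $[0,\infty]$-valued, with $0/0=0$ and $s/0=\infty$ for $s>0$). Here $L_0(\nu)$ is the space of $\nu$-a.e. classes of real measurable functions on $\Omega$. A Banach function space $Y(\nu)$ is a linear subspace of $L_0(\nu)$ with a complete norm such that: if $|x|\le|y|$, $x\in L_0(\nu)$ and $y\in Y(\nu)$, then $x\in Y(\nu)$ and $\|x\|_Y\le\|y\|_Y$; the support of $Y(\nu)$ is $\Omega$, i.e. every measurable set on which all functions of $Y(\nu)$ vanish a.e. is a $\nu$-null set; and $\|x_n\|_Y\to\|x\|_Y$ whenever $0\le x_n\uparrow x$ a.e. with $x_n,x\in Y(\nu)$. It is $r$-concave if there is $c\ge 0$ such that $(\sum_{k=1}^n\|y_k\|_Y^r)^{1/r}\le c\,\|(\sum_{k=1}^n|y_k|^r)^{1/r}\|_Y$ for all $n$ and all $y_1,\dots,y_n\in Y(\nu)$. -/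

import Mathlib

open MeasureTheory Filter Topology
open scoped ENNReal

universe u v w

/-! ### The element `(∑ |x k| ^ r) ^ (1 / r)` of a Banach lattice -/

/-- The coefficient vectors `a` of the linear forms `t ↦ ∑ a k * t k` on `ℝⁿ` which lie below
`t ↦ (∑ |t k| ^ r) ^ (1 / r)`. For `1 ≤ r < ∞` this is the closed unit ball of `ℓ_{r'}ⁿ`,
`1 / r + 1 / r' = 1`. -/
def dualBall (r : ℝ) (n : ℕ) : Set (Fin n → ℝ) :=
  {a | ∀ t : Fin n → ℝ, ∑ k, a k * t k ≤ (∑ k, |t k| ^ r) ^ (1 / r)}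

theorem zero_mem_dualBall (r : ℝ) (n : ℕ) : (0 : Fin n → ℝ) ∈ dualBall r n := by
  intro t
  simp only [Pi.zero_apply, zero_mul, Finset.sum_const_zero]
  positivity

theorem abs_le_one_of_mem_dualBall {r : ℝ} {n : ℕ} {a : Fin n → ℝ} (ha : a ∈ dualBall r n)
    (k : Fin n) : |a k| ≤ 1 := by
  have key : ∀ c : ℝ, |c| = 1 → a k * c ≤ 1 := by
    intro c hc
    have h := ha (Pi.single k c)
    have h1 : ∑ j, a j * (Pi.single k c : Fin n → ℝ) j = a k * c := by
      rw [Finset.sum_eq_single k]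
      · simp
      · intro j _ hj
        simp [Pi.single_eq_of_ne hj]
      · simp
    rw [h1] at h
    rcases eq_or_ne r 0 with rfl | hr
    · simpa using h
    · have h2 : ∑ j, |(Pi.single k c : Fin n → ℝ) j| ^ r = 1 := by
        rw [Finset.sum_eq_single k]
        · simp [hc]
        · intro j _ hj
          simp [Pi.single_eq_of_ne hj, Real.zero_rpow hr]
        · simp
      rw [h2, Real.one_rpow] at h
      exact h
  rw [abs_le]
  have h1 := key 1 (by simp)
  have h2 := key (-1) (by simp)
  constructor <;> linarith

section BanachLattice

variable {E : Type*} [NormedAddCommGroup E] [Lattice E] [HasSolidNorm E] [IsOrderedAddMonoid E]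
  [NormedSpace ℝ E] [IsOrderedModule ℝ E] [CompleteSpace E]

theorem exists_isLUB_dualBall (r : ℝ) {n : ℕ} (x : Fin n → E) :
    ∃ z : E, IsLUB ((fun a : Fin n → ℝ => ∑ k, a k • x k) '' dualBall r n) z := by
  classical
  set L : (Fin n → ℝ) → E := fun a => ∑ k, a k • x k with hL
  set e : E := ∑ k, |x k| with he
  have he0 : 0 ≤ e := Finset.sum_nonneg fun k _ => abs_nonneg _
  let z0 : dualBall r n := ⟨0, zero_mem_dualBall r n⟩
  have hLle : ∀ (a b : Fin n → ℝ) (ε : ℝ), dist a b ≤ ε → L a ≤ L b + ε • e := by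
    intro a b ε h
    have : L a - L b ≤ ε • e := by
      simp only [hL, he, ← Finset.sum_sub_distrib, Finset.smul_sum, ← sub_smul]
      refine Finset.sum_le_sum fun k _ => ?_
      have h1 : |a k - b k| ≤ ε := by
        have := dist_le_pi_dist a b k
        rw [Real.dist_eq] at this
        exact this.trans h
      have h3 : (a k - b k) • x k ≤ |a k - b k| • |x k| := by
        rcases le_total 0 (a k - b k) with h0 | h0
        · rw [abs_of_nonneg h0]
          exact smul_le_smul_of_nonneg_left (le_abs_self _) h0
        · rw [abs_of_nonpos h0, ← neg_smul_neg (a k - b k) (x k)]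
          exact smul_le_smul_of_nonneg_left (neg_le_abs _) (neg_nonneg.2 h0)
      exact h3.trans (smul_le_smul_of_nonneg_right h1 (abs_nonneg _))
    rwa [sub_le_iff_le_add'] at this
  let s : Finset (dualBall r n) → E := fun F =>
    (insert z0 F).sup' (Finset.insert_nonempty _ _) fun a => L a
  have hmono : Monotone s := fun F G h =>
    Finset.sup'_mono _ (Finset.insert_subset_insert _ h) _
  have hbdd : TotallyBounded (dualBall r n) := by
    have hK : TotallyBounded (Metric.closedBall (0 : Fin n → ℝ) 1) :=
      (isCompact_closedBall (0 : Fin n → ℝ) 1).totallyBounded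
    refine hK.subset ?_
    intro a ha
    rw [mem_closedBall_zero_iff, pi_norm_le_iff_of_nonneg zero_le_one]
    exact fun k => abs_le_one_of_mem_dualBall ha k
  have hcau : CauchySeq s := by
    rw [Metric.cauchySeq_iff']
    intro ε hε
    obtain ⟨δ, hδ, hδε⟩ : ∃ δ : ℝ, 0 < δ ∧ δ * ‖e‖ < ε := by
      refine ⟨ε / (‖e‖ + 1), by positivity, ?_⟩
      rw [div_mul_eq_mul_div, div_lt_iff₀ (by positivity)]
      nlinarith [norm_nonneg e]
    obtain ⟨t, htS, htfin, hcov⟩ := Metric.finite_approx_of_totallyBounded hbdd δ hδ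
    let N : Finset (dualBall r n) := (htfin.toFinset).subtype (· ∈ dualBall r n)
    refine ⟨N, fun F hF => ?_⟩
    have h1 : s N ≤ s F := hmono hF
    have h2 : s F ≤ s N + δ • e := by
      refine Finset.sup'_le _ _ fun a _ => ?_
      obtain ⟨b, hb, hab⟩ := Set.mem_iUnion₂.1 (hcov a.2)
      refine (hLle a b δ (Metric.mem_ball.1 hab).le).trans ?_
      have : L b ≤ s N :=
        Finset.le_sup' (f := fun a : dualBall r n => L a) (b := ⟨b, htS hb⟩)
          (Finset.mem_insert_of_mem (by simpa [N] using hb))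
      exact add_le_add_left this _
    have h3 : ‖s F - s N‖ ≤ ‖δ • e‖ := by
      refine norm_le_norm_of_abs_le_abs ?_
      rw [abs_of_nonneg (sub_nonneg.2 h1), abs_of_nonneg (smul_nonneg hδ.le he0)]
      exact sub_le_iff_le_add'.2 h2
    rw [dist_eq_norm]
    refine h3.trans_lt ?_
    rwa [norm_smul, Real.norm_of_nonneg hδ.le]
  obtain ⟨z, hz⟩ := cauchySeq_tendsto_of_complete hcau
  have hlub := isLUB_of_tendsto_atTop hmono hz
  refine ⟨z, ?_, ?_⟩
  · rintro _ ⟨a, ha, rfl⟩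
    refine le_trans ?_ (hlub.1 ⟨{⟨a, ha⟩}, rfl⟩)
    exact Finset.le_sup' (f := fun a : dualBall r n => L a) (b := ⟨a, ha⟩) (by simp)
  · intro b hb
    refine hlub.2 ?_
    rintro _ ⟨F, rfl⟩
    exact Finset.sup'_le _ _ fun a _ => hb ⟨a, a.2, rfl⟩

/-- The element `(∑ |x k| ^ r) ^ (1 / r)`, `1 ≤ r < ∞`, of a Banach lattice: the least upper bound
of all `∑ a k • x k` with `a` in the closed unit ball of `ℓ_{r'}ⁿ`. -/
noncomputable def latticeSum (r : ℝ) {n : ℕ} (x : Fin n → E) : E :=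
  Classical.choose (exists_isLUB_dualBall r x)

theorem isLUB_latticeSum (r : ℝ) {n : ℕ} (x : Fin n → E) :
    IsLUB ((fun a : Fin n → ℝ => ∑ k, a k • x k) '' dualBall r n) (latticeSum r x) :=
  Classical.choose_spec (exists_isLUB_dualBall r x)

variable (E) in
/-- `r`-convexity of a Banach lattice. -/
def IsRConvexLattice (r : ℝ) : Prop :=
  ∃ c : ℝ, 0 ≤ c ∧ ∀ (n : ℕ) (x : Fin n → E),
    ‖latticeSum r x‖ ≤ c * (∑ k, ‖x k‖ ^ r) ^ (1 / r)

/-- `r`-convexity of an operator from a Banach space into a Banach lattice. -/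
def IsRConvexOperator {X : Type*} [NormedAddCommGroup X] [NormedSpace ℝ X] (r : ℝ)
    (T : X →L[ℝ] E) : Prop :=
  ∃ c : ℝ, 0 ≤ c ∧ ∀ (n : ℕ) (x : Fin n → X),
    ‖latticeSum r (fun k => T (x k))‖ ≤ c * (∑ k, ‖x k‖ ^ r) ^ (1 / r)

end BanachLattice

/-! ### Banach function spaces -/

section FunctionSpace

variable {Ω : Type*} [MeasurableSpace Ω] {ν : Measure Ω}

/-- The pointwise power `f ^ s` in `L₀(ν)`. -/
noncomputable def l0Pow (f : Ω →ₘ[ν] ℝ) (s : ℝ) : Ω →ₘ[ν] ℝ :=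
  f.compMeasurable (fun t : ℝ => t ^ s) (measurable_id.pow_const s)

/-- The function `(∑ |x k| ^ r) ^ (1 / r)` in `L₀(ν)`, formed pointwise. -/
noncomputable def l0Sum (r : ℝ) {n : ℕ} (x : Fin n → (Ω →ₘ[ν] ℝ)) : Ω →ₘ[ν] ℝ :=
  l0Pow (∑ k, l0Pow |x k| r) (1 / r)

variable (ν) in
/-- A Banach function space `Y(ν)`, given by its norm, which is extended to `L₀(ν)` by the
value `∞` off the space: `Y(ν) = {y ∈ L₀(ν) | ‖y‖ < ∞}`. -/
structure BanachFunctionSpace where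
  /-- the norm, with value `∞` off the space -/
  nrm : (Ω →ₘ[ν] ℝ) → ℝ≥0∞
  nrm_eq_zero : ∀ y, nrm y = 0 ↔ y = 0
  nrm_smul : ∀ (c : ℝ) (y), nrm (c • y) = ENNReal.ofReal |c| * nrm y
  nrm_add_le : ∀ y z, nrm (y + z) ≤ nrm y + nrm z
  /-- the space is an ideal of `L₀(ν)` and the norm is monotone -/
  nrm_mono : ∀ y z, |y| ≤ |z| → nrm y ≤ nrm z
  /-- the support of the space is all of `Ω` -/
  support : ∀ A : Set Ω, MeasurableSet A →
    (∀ y, nrm y < ∞ → ∀ᵐ t ∂ν, t ∈ A → y t = 0) → ν A = 0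
  /-- the Fatou property -/
  fatou : ∀ (y : ℕ → (Ω →ₘ[ν] ℝ)) (z : Ω →ₘ[ν] ℝ), nrm z < ∞ → (∀ i, 0 ≤ y i) → Monotone y →
    (∀ᵐ t ∂ν, Tendsto (fun i => y i t) atTop (𝓝 (z t))) →
    Tendsto (fun i => nrm (y i)) atTop (𝓝 (nrm z))
  /-- the space is complete -/
  complete : ∀ y : ℕ → (Ω →ₘ[ν] ℝ), (∀ i, nrm (y i) < ∞) →
    (∀ ε : ℝ≥0∞, 0 < ε → ∃ N, ∀ i ≥ N, ∀ j ≥ N, nrm (y i - y j) ≤ ε) →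
    ∃ z, nrm z < ∞ ∧ Tendsto (fun i => nrm (y i - z)) atTop (𝓝 0)

/-- `r`-concavity of a Banach function space. -/
def BanachFunctionSpace.IsRConcave (Y : BanachFunctionSpace ν) (r : ℝ) : Prop :=
  ∃ c : ℝ, 0 ≤ c ∧ ∀ (n : ℕ) (y : Fin n → (Ω →ₘ[ν] ℝ)), (∀ k, Y.nrm (y k) < ∞) →
    (∑ k, Y.nrm (y k) ^ r) ^ (1 / r) ≤ ENNReal.ofReal c * Y.nrm (l0Sum r y)

/-- A linear map into `L₀(ν)` is an operator (bounded and linear) into `Y(ν)`. In particular all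
its values lie in `Y(ν)`. -/
def BanachFunctionSpace.IsOperatorInto {X : Type*} [NormedAddCommGroup X] [NormedSpace ℝ X]
    (Y : BanachFunctionSpace ν) (T : X →ₗ[ℝ] (Ω →ₘ[ν] ℝ)) : Prop :=
  ∃ c : ℝ, 0 ≤ c ∧ ∀ x, Y.nrm (T x) ≤ ENNReal.ofReal (c * ‖x‖)

/-- The weighted norm inequality: there is a weight `0 ≤ ω ∈ L₀(ν)` such that `ω ^ (1 / r)` is a
bounded multiplier from `L_r(ν)` into `Y(ν)` and `(∫ |Tx| ^ r / ω dν) ^ (1 / r) ≤ ‖x‖` for all `x`.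
The integral is that of a `[0, ∞]`-valued function, with `0 / 0 = 0` and `s / 0 = ∞` for
`s > 0`. -/
def BanachFunctionSpace.WeightedInequality {X : Type*} [NormedAddCommGroup X] [NormedSpace ℝ X]
    (Y : BanachFunctionSpace ν) (r : ℝ) (T : X →ₗ[ℝ] (Ω →ₘ[ν] ℝ)) : Prop :=
  ∃ ω : Ω →ₘ[ν] ℝ, 0 ≤ ω ∧
    (⨆ (y : Ω →ₘ[ν] ℝ) (_ : eLpNorm y (ENNReal.ofReal r) ν ≤ 1), Y.nrm (l0Pow ω (1 / r) * y)) < ∞ ∧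
    ∀ x, (∫⁻ t, ENNReal.ofReal (|T x t| ^ r) / ENNReal.ofReal (ω t) ∂ν) ^ (1 / r)
      ≤ ENNReal.ofReal ‖x‖

end FunctionSpace

/-! ### The dual ball -/

/-! From (1) to (2): a positive `T` preserves the inequalities `∑ a k • x k ≤ latticeSum r x`, so
`latticeSum r (T x) ≤ T (latticeSum r x)`, and the norm of `T` times the convexity constant serves
for `T`.

From (1) to (3), a Maurey-type factorization. Convexity of `E`, positivity of `T` and concavity of
`Y` give `∑ ‖y j‖ ^ r ≤ K * ∑ ‖x k‖ ^ r` whenever `∑ |y j| ^ r ≤ ∑ |T (x k)| ^ r` a.e.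
(`exists_forall_sum_nrm_rpow_le`). Fix `x₀ ≥ 0` such that `T x₀` has the largest support. A
Hahn–Banach sandwich (`exists_linearMap_simpleFunc`) produces a linear functional `l` on the simple
functions with `‖y‖ ^ r / K ≤ l φ` if `|y| ^ r ≤ φ |T x₀| ^ r`, and `l φ ≤ ‖x‖ ^ r` if `φ |T x₀| ^ r
≤ |T x| ^ r`. It is a finitely additive measure; its countably additive part `μ` lies below `l`,
which keeps the second bound, and differs from `l` by little on sets increasing to `Ω`, so the Fatou
property keeps the first (`exists_measure`). With `u = dμ/dν` the weight is `ω = |T x₀| ^ r / u`.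

Back to (1): if `E` is not `r`-convex, there are `x` whose lattice sums are arbitrarily large
relative to `(∑ ‖x k‖ ^ r) ^ (1 / r)`. Such a sum is nearly a finite supremum of vectors `∑ a k • x
k`, and Hahn–Banach yields finitely many positive functionals that recover the norm of the supremum,
hence a positive contraction into a finite-dimensional `ℓ₁`. A weighted direct sum of these is a
positive operator into `ℓ₁` that is not `r`-convex, against (2). Since `ℓ₁` is `r`-concave and a
weighted inequality forces `r`-convexity of the operator, (3) is violated as well. -/

theorem exists_mem_dualBall_sum_eq {r : ℝ} (hr : 1 ≤ r) {n : ℕ} (t : Fin n → ℝ) :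
    ∃ a ∈ dualBall r n, ∑ k, a k * t k = (∑ k, |t k| ^ r) ^ (1 / r) := by
  have hr0 : 0 < r := by linarith
  have : Fact (1 ≤ ENNReal.ofReal r) := ⟨by simpa using hr⟩
  have htr : (ENNReal.ofReal r).toReal = r := ENNReal.toReal_ofReal hr0.le
  have hnorm : ∀ s : Fin n → ℝ, ‖WithLp.toLp (ENNReal.ofReal r) s‖ = (∑ k, |s k| ^ r) ^ (1 / r) := by
    intro s
    rw [PiLp.norm_eq_sum (by rw [htr]; exact hr0), htr]
    simp [Real.norm_eq_abs]
  -- A norming functional of `t` in `ℓ_rⁿ`; its coordinates are the required coefficients, so the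
  -- conjugate exponent never appears.
  obtain ⟨g, hg, hgt⟩ := exists_dual_vector'' ℝ (WithLp.toLp (ENNReal.ofReal r) t)
  let b : Fin n → ℝ := fun k => g (WithLp.toLp (ENNReal.ofReal r) (Pi.single k 1))
  have hb : ∀ s : Fin n → ℝ, ∑ k, b k * s k = g (WithLp.toLp (ENNReal.ofReal r) s) := by
    intro s
    have : WithLp.toLp (ENNReal.ofReal r) s
        = ∑ k, s k • WithLp.toLp (ENNReal.ofReal r) (Pi.single k 1 : Fin n → ℝ) := by
      ext i
      simp [Finset.sum_apply, Pi.single_apply]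
    rw [this, map_sum]
    refine Finset.sum_congr rfl fun k _ => ?_
    rw [map_smul, smul_eq_mul, mul_comm]
  refine ⟨b, fun s => ?_, ?_⟩
  · rw [hb, ← hnorm]
    refine (le_abs_self _).trans ?_
    rw [← Real.norm_eq_abs]
    exact (g.le_of_opNorm_le hg _).trans_eq (one_mul _)
  · rw [hb, hgt, hnorm]
    rfl

/-- The sums depend continuously on `a`, so a dense subset of the ball detects the `r`-norm.
Countability allows inequalities that hold a.e. for each single `a` to hold off one common null set.
-/
theorem exists_countable_forall_rpow_sum_le {r : ℝ} (hr : 1 ≤ r) (n : ℕ) :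
    ∃ D : Set (Fin n → ℝ), D.Countable ∧ D ⊆ dualBall r n ∧
      ∀ (t : Fin n → ℝ) (M : ℝ), (∀ a ∈ D, ∑ k, a k * t k ≤ M) →
        (∑ k, |t k| ^ r) ^ (1 / r) ≤ M := by
  obtain ⟨D, hDs, hDc, hD⟩ := 
    (TopologicalSpace.IsSeparable.of_separableSpace (dualBall r n)).exists_countable_dense_subset
  refine ⟨D, hDc, hDs, fun t M h => ?_⟩
  obtain ⟨a, ha, hat⟩ := exists_mem_dualBall_sum_eq hr t
  rw [← hat]
  have hcl : IsClosed {a : Fin n → ℝ | ∑ k, a k * t k ≤ M} :=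
    isClosed_le (by fun_prop) continuous_const
  exact hcl.closure_subset_iff.2 h (hD ha)

/-! ### The element `latticeSum` -/

theorem norm_le_norm_of_nonneg_of_le {E : Type*} [NormedAddCommGroup E] [Lattice E]
    [HasSolidNorm E] [IsOrderedAddMonoid E] {x y : E} (hx : 0 ≤ x) (hxy : x ≤ y) : ‖x‖ ≤ ‖y‖ :=
  norm_le_norm_of_abs_le_abs (by rwa [abs_of_nonneg hx, abs_of_nonneg (hx.trans hxy)])

theorem smul_le_abs_smul_abs {E : Type*} [AddCommGroup E] [Lattice E] [IsOrderedAddMonoid E]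
    [Module ℝ E] [IsOrderedModule ℝ E] (c : ℝ) (x : E) : c • x ≤ |c| • |x| := by
  rcases le_total 0 c with h0 | h0
  · rw [abs_of_nonneg h0]
    exact smul_le_smul_of_nonneg_left (le_abs_self _) h0
  · rw [abs_of_nonpos h0, ← neg_smul_neg c x]
    exact smul_le_smul_of_nonneg_left (neg_le_abs _) (neg_nonneg.2 h0)

section BanachLattice

variable {E : Type*} [NormedAddCommGroup E] [Lattice E] [HasSolidNorm E] [IsOrderedAddMonoid E]
  [NormedSpace ℝ E] [IsOrderedModule ℝ E] [CompleteSpace E]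

theorem sum_smul_le_latticeSum {r : ℝ} {n : ℕ} {a : Fin n → ℝ} (ha : a ∈ dualBall r n)
    (x : Fin n → E) : ∑ k, a k • x k ≤ latticeSum r x :=
  (isLUB_latticeSum r x).1 ⟨a, ha, rfl⟩

theorem latticeSum_nonneg (r : ℝ) {n : ℕ} (x : Fin n → E) : 0 ≤ latticeSum r x := by
  simpa using sum_smul_le_latticeSum (zero_mem_dualBall r n) x

/-- `T (latticeSum r x)` is an upper bound of all `∑ a k • T (x k)`, because `T` is linear and
monotone. -/
theorem latticeSum_map_le {Y : Type*} [NormedAddCommGroup Y] [Lattice Y] [HasSolidNorm Y]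
    [IsOrderedAddMonoid Y] [NormedSpace ℝ Y] [IsOrderedModule ℝ Y] [CompleteSpace Y]
    (T : E →L[ℝ] Y) (hT : ∀ x, 0 ≤ x → 0 ≤ T x) (r : ℝ) {n : ℕ} (x : Fin n → E) :
    latticeSum r (fun k => T (x k)) ≤ T (latticeSum r x) := by
  refine (isLUB_latticeSum r _).2 ?_
  rintro _ ⟨a, ha, rfl⟩
  have := hT _ (sub_nonneg.2 (sum_smul_le_latticeSum ha x))
  rw [map_sub, sub_nonneg] at this
  simpa using this

theorem IsRConvexLattice.isRConvexOperator {r : ℝ} (h : IsRConvexLattice E r) {Y : Type*}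
    [NormedAddCommGroup Y] [Lattice Y] [HasSolidNorm Y]
    [IsOrderedAddMonoid Y] [NormedSpace ℝ Y] [IsOrderedModule ℝ Y] [CompleteSpace Y]
    (T : E →L[ℝ] Y) (hT : ∀ x, 0 ≤ x → 0 ≤ T x) : IsRConvexOperator r T := by
  obtain ⟨c, hc, h⟩ := h
  refine ⟨‖T‖ * c, by positivity, fun n x => ?_⟩
  calc _ ≤ ‖T (latticeSum r x)‖ :=
        norm_le_norm_of_nonneg_of_le (latticeSum_nonneg _ _) (latticeSum_map_le T hT r x)
    _ ≤ ‖T‖ * ‖latticeSum r x‖ := T.le_opNorm _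
    _ ≤ ‖T‖ * (c * (∑ k, ‖x k‖ ^ r) ^ (1 / r)) := by gcongr; exact h n x
    _ = _ := by ring

/-- `latticeSum` is the norm limit of finite suprema. -/
theorem exists_finset_norm_latticeSum_sub_lt (r : ℝ) {n : ℕ} (x : Fin n → E) {ε : ℝ}
    (hε : 0 < ε) : ∃ (F : Finset (Fin n → ℝ)) (hF : F.Nonempty), 0 ∈ F ∧ (∀ a ∈ F, a ∈ dualBall r n) ∧
      ‖latticeSum r x - F.sup' hF (fun a => ∑ k, a k • x k)‖ < ε := by
  classical
  set e : E := ∑ k, |x k| with he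
  have he0 : 0 ≤ e := Finset.sum_nonneg fun k _ => abs_nonneg _
  obtain ⟨δ, hδ, hδε⟩ : ∃ δ : ℝ, 0 < δ ∧ δ * ‖e‖ < ε := by
    refine ⟨ε / (‖e‖ + 1), by positivity, ?_⟩
    rw [div_mul_eq_mul_div, div_lt_iff₀ (by positivity)]
    nlinarith [norm_nonneg e]
  have hbdd : TotallyBounded (dualBall r n) := by
    refine (isCompact_closedBall (0 : Fin n → ℝ) 1).totallyBounded.subset fun a ha => ?_
    rw [mem_closedBall_zero_iff, pi_norm_le_iff_of_nonneg zero_le_one]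
    exact fun k => abs_le_one_of_mem_dualBall ha k
  obtain ⟨t, htS, htfin, hcov⟩ := Metric.finite_approx_of_totallyBounded hbdd δ hδ
  -- Adding `0` to the `δ`-net makes it nonempty and its supremum nonnegative.
  have hF : (insert 0 htfin.toFinset : Finset (Fin n → ℝ)).Nonempty := Finset.insert_nonempty _ _
  have hmem : ∀ a ∈ (insert 0 htfin.toFinset : Finset (Fin n → ℝ)), a ∈ dualBall r n := by
    intro a ha
    rcases Finset.mem_insert.1 ha with rfl | ha
    · exact zero_mem_dualBall r n
    · exact htS (by simpa using ha)
  refine ⟨insert 0 htfin.toFinset, hF, Finset.mem_insert_self _ _, hmem, ?_⟩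
  set s := (insert 0 htfin.toFinset).sup' hF (fun a => ∑ k, a k • x k) with hs
  have h1 : s ≤ latticeSum r x := Finset.sup'_le _ _ fun a ha => sum_smul_le_latticeSum (hmem a ha) x
  have h2 : latticeSum r x ≤ s + δ • e := by
    refine (isLUB_latticeSum r x).2 ?_
    rintro _ ⟨a, ha, rfl⟩
    obtain ⟨b, hb, hab⟩ := Set.mem_iUnion₂.1 (hcov ha)
    have hbs : ∑ k, b k • x k ≤ s :=
      Finset.le_sup' (f := fun a : Fin n → ℝ => ∑ k, a k • x k)
        (Finset.mem_insert_of_mem (by simpa using hb))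
    have hab' : ∑ k, a k • x k ≤ ∑ k, b k • x k + δ • e := by
      rw [← sub_le_iff_le_add', he, ← Finset.sum_sub_distrib, Finset.smul_sum]
      refine Finset.sum_le_sum fun k _ => ?_
      rw [← sub_smul]
      refine (smul_le_abs_smul_abs _ _).trans (smul_le_smul_of_nonneg_right ?_ (abs_nonneg _))
      have := (dist_le_pi_dist a b k).trans (Metric.mem_ball.1 hab).le
      rwa [Real.dist_eq] at this
    exact hab'.trans (add_le_add_left hbs _)
  calc _ ≤ ‖δ • e‖ := norm_le_norm_of_nonneg_of_le (sub_nonneg.2 h1) (sub_le_iff_le_add'.2 h2)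
    _ < ε := by rwa [norm_smul, Real.norm_of_nonneg hδ.le]

end BanachLattice

/-- Positive functionals which sum up to a contraction on the positive cone and which attain the
norm of the positive part of a finite supremum. -/
theorem exists_positive_functionals_norm_sup' {E : Type*} [NormedAddCommGroup E] [Lattice E]
    [HasSolidNorm E] [IsOrderedAddMonoid E] [NormedSpace ℝ E] [IsOrderedModule ℝ E] {ι : Type*} [Fintype ι] [Nonempty ι] (w : ι → E) :
    ∃ y : ι → (E →ₗ[ℝ] ℝ), (∀ j x, 0 ≤ x → 0 ≤ y j x) ∧ (∀ x, ∑ j, y j x ≤ ‖x‖) ∧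
      ∑ j, y j (w j) = ‖(Finset.univ.sup' Finset.univ_nonempty w)⁺‖ := by
  classical
  -- By `hple` and `hle`, `p v` is the least norm of a nonnegative upper bound of all `v j`;
  -- sublinearity follows. The positive part makes `p` vanish on families `≤ 0`, so every linear
  -- functional below `p` is positive in each coordinate.
  let p : (ι → E) → ℝ := fun v => ‖(Finset.univ.sup' Finset.univ_nonempty v)⁺‖
  have hple : ∀ (v : ι → E) (z : E), 0 ≤ z → (∀ j, v j ≤ z) → p v ≤ ‖z‖ := fun v z hz hv =>
    norm_le_norm_of_nonneg_of_le (posPart_nonneg _)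
      (sup_le (Finset.sup'_le _ _ fun j _ => hv j) hz)
  have hle : ∀ (v : ι → E) j, v j ≤ (Finset.univ.sup' Finset.univ_nonempty v)⁺ := fun v j =>
    (Finset.le_sup' v (Finset.mem_univ j)).trans (le_posPart _)
  have hsub : ∀ v v', p (v + v') ≤ p v + p v' := fun v v' =>
    (hple _ _ (add_nonneg (posPart_nonneg _) (posPart_nonneg _))
      fun j => add_le_add (hle v j) (hle v' j)).trans (norm_add_le _ _)
  have hhom1 : ∀ c : ℝ, 0 < c → ∀ v, p (c • v) ≤ c * p v := by
    intro c hc v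
    refine (hple (c • v) _ (smul_nonneg hc.le (posPart_nonneg _))
      fun j => smul_le_smul_of_nonneg_left (hle v j) hc.le).trans_eq ?_
    rw [norm_smul, Real.norm_of_nonneg hc.le]
  have hhom : ∀ c : ℝ, 0 < c → ∀ v, p (c • v) = c * p v := by
    intro c hc v
    refine le_antisymm (hhom1 c hc v) ?_
    have := hhom1 c⁻¹ (inv_pos.2 hc) (c • v)
    rw [inv_smul_smul₀ hc.ne'] at this
    calc c * p v ≤ c * (c⁻¹ * p (c • v)) := by gcongr
      _ = p (c • v) := by rw [← mul_assoc, mul_inv_cancel₀ hc.ne', one_mul]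
  have hp0 : p 0 = 0 := by
    refine le_antisymm ((hple 0 0 le_rfl fun j => le_rfl).trans_eq norm_zero) (norm_nonneg _)
  have hH : ∀ c : ℝ, c • w = 0 → RingHom.id ℝ c • p w = 0 := fun c hc => by
    rcases smul_eq_zero.1 hc with rfl | hw
    · simp
    · rw [hw, hp0, smul_zero]
  obtain ⟨g, hg1, hg⟩ := exists_extension_of_le_sublinear
    (LinearPMap.mkSpanSingleton' w (p w) hH) p hhom hsub (by
      rintro ⟨x, hx⟩
      obtain ⟨c, rfl⟩ := Submodule.mem_span_singleton.1 hx
      rw [LinearPMap.mkSpanSingleton'_apply]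
      simp only [RingHom.id_apply, smul_eq_mul]
      rcases lt_trichotomy c 0 with hc | rfl | hc
      · have h1 : p 0 ≤ p (c • w) + p ((-c) • w) := by
          simpa using hsub (c • w) ((-c) • w)
        rw [hp0, hhom (-c) (neg_pos.2 hc)] at h1
        linarith
      · simp [hp0]
      · rw [hhom c hc])
  have hgw : g w = p w :=
    (hg1 ⟨w, Submodule.mem_span_singleton_self w⟩).trans
      (LinearPMap.mkSpanSingleton'_apply_self w (p w) hH _)
  refine ⟨fun j => g ∘ₗ LinearMap.single ℝ (fun _ => E) j, fun j x hx => ?_, fun x => ?_, ?_⟩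
  · have h1 := hg (Pi.single j (-x))
    have h2 : p (Pi.single j (-x)) ≤ ‖(0 : E)‖ := by
      refine hple _ _ le_rfl fun i => ?_
      rcases eq_or_ne i j with rfl | hij
      · simpa using hx
      · simp [Pi.single_eq_of_ne hij]
    have h3 : g (Pi.single j (-x)) = - g (Pi.single j x) := by
      rw [Pi.single_neg, map_neg]
    rw [norm_zero] at h2
    simp only [LinearMap.comp_apply, LinearMap.coe_single]
    linarith
  · have h1 : ∑ j, (g ∘ₗ LinearMap.single ℝ (fun _ => E) j) x = g (fun _ => x) := by
      simp only [LinearMap.comp_apply, LinearMap.coe_single]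
      rw [← map_sum]
      congr 1
      exact Finset.univ_sum_single (fun _ : ι => x)
    rw [h1]
    refine (hg _).trans ((hple _ |x| (abs_nonneg _) fun j => le_abs_self _).trans_eq (norm_abs_eq_norm _))
  · simp only [LinearMap.comp_apply, LinearMap.coe_single]
    rw [← map_sum, Finset.univ_sum_single, hgw]

/-! ### Separation by a linear functional, and its countably additive part -/

section FunctionSpace

variable {Ω : Type*} [MeasurableSpace Ω] {ν : Measure Ω}

/-- A sandwich theorem: a functional `S` on `L₀(ν)`, concave in `|y| ^ r`, and the functional
`‖x‖ ^ r`, convex in `|T x| ^ r`, are separated by a linear functional. -/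
theorem exists_linearMap_simpleFunc {X : Type*} [NormedAddCommGroup X] [NormedSpace ℝ X] {r : ℝ}
    (hr : 0 < r) (T : X →ₗ[ℝ] (Ω →ₘ[ν] ℝ)) (x₀ : X) (S : (Ω →ₘ[ν] ℝ) → ℝ)
    (hS : ∀ (c : ℝ) y, 0 ≤ c → S (c • y) = c ^ r * S y)
    (H : ∀ (xs : List X) (ys : List (Ω →ₘ[ν] ℝ)),
      (∀ᵐ t ∂ν, (ys.map fun y => |y t| ^ r).sum ≤ (xs.map fun x => |T x t| ^ r).sum) →
      (ys.map S).sum ≤ (xs.map fun x => ‖x‖ ^ r).sum) :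
    ∃ l : (SimpleFunc Ω ℝ) →ₗ[ℝ] ℝ,
      (∀ φ y, (∀ᵐ t ∂ν, |y t| ^ r ≤ φ t * |T x₀ t| ^ r) → S y ≤ l φ) ∧
      (∀ φ x, (∀ᵐ t ∂ν, φ t * |T x₀ t| ^ r ≤ |T x t| ^ r) → l φ ≤ ‖x‖ ^ r) := by
  have hT : ∀ c : ℝ, 0 ≤ c → ∀ x, ∀ᵐ t ∂ν, |T (c ^ (1 / r) • x) t| ^ r = c * |T x t| ^ r := by
    intro c hc x
    rw [map_smul]
    filter_upwards [AEEqFun.coeFn_smul (c ^ (1 / r)) (T x)] with t ht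
    rw [ht, Pi.smul_apply, smul_eq_mul, abs_mul, abs_of_nonneg (by positivity),
      Real.mul_rpow (by positivity) (abs_nonneg _), ← Real.rpow_mul hc, one_div_mul_cancel hr.ne',
      Real.rpow_one]
  have hY : ∀ c : ℝ, 0 ≤ c → ∀ y : Ω →ₘ[ν] ℝ, ∀ᵐ t ∂ν,
      |(c ^ (1 / r) • y : Ω →ₘ[ν] ℝ) t| ^ r = c * |y t| ^ r := by
    intro c hc y
    filter_upwards [AEEqFun.coeFn_smul (c ^ (1 / r)) y] with t ht
    rw [ht, Pi.smul_apply, smul_eq_mul, abs_mul, abs_of_nonneg (by positivity),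
      Real.mul_rpow (by positivity) (abs_nonneg _), ← Real.rpow_mul hc, one_div_mul_cancel hr.ne',
      Real.rpow_one]
  -- `(φ, s)` lies in `C` if `s` is a lower bound for `l φ` forced by finitely many of the desired
  -- inequalities. Concatenating lists adds elements, and scaling vectors by `c ^ (1 / r)`
  -- multiplies by `c`, so `C` is a convex cone although neither `S` nor `‖·‖ ^ r` is additive.
  let C : PointedCone ℝ (SimpleFunc Ω ℝ × ℝ) :=
    { carrier := {q | ∃ (xs : List X) (ys : List (Ω →ₘ[ν] ℝ)),
        (∀ᵐ t ∂ν, (ys.map fun y => |y t| ^ r).sum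
          ≤ q.1 t * |T x₀ t| ^ r + (xs.map fun x => |T x t| ^ r).sum) ∧
        q.2 ≤ (ys.map S).sum - (xs.map fun x => ‖x‖ ^ r).sum}
      add_mem' := by
        rintro ⟨φ, s⟩ ⟨φ', s'⟩ ⟨xs, ys, h, hs⟩ ⟨xs', ys', h', hs'⟩
        refine ⟨xs ++ xs', ys ++ ys', ?_, ?_⟩
        · filter_upwards [h, h'] with t ht ht'
          simp only [List.map_append, List.sum_append, Prod.mk_add_mk, SimpleFunc.coe_add,
            Pi.add_apply] at ht ht' ⊢
          linarith
        · simp only [List.map_append, List.sum_append, Prod.mk_add_mk] at hs hs' ⊢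
          linarith
      zero_mem' := ⟨[], [], by simp, by simp⟩
      smul_mem' := by
        rintro ⟨c, hc⟩ ⟨φ, s⟩ ⟨xs, ys, h, hs⟩
        refine ⟨xs.map fun x => c ^ (1 / r) • x, ys.map fun y => c ^ (1 / r) • y, ?_, ?_⟩
        · have h1 := (ae_ball_iff (List.finite_toSet xs).countable).2 fun x _ => hT c hc x
          have h2 := (ae_ball_iff (List.finite_toSet ys).countable).2 fun y _ => hY c hc y
          filter_upwards [h, h1, h2] with t ht h1 h2
          have e1 : ((xs.map fun x => c ^ (1 / r) • x).map fun x => |T x t| ^ r).sum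
              = c * (xs.map fun x => |T x t| ^ r).sum := by
            rw [List.map_map, ← List.sum_map_mul_left]
            congr 1
            exact List.map_congr_left fun x hx => h1 x hx
          have e2 : ((ys.map fun y => c ^ (1 / r) • y).map fun y => |y t| ^ r).sum
              = c * (ys.map fun y => |y t| ^ r).sum := by
            rw [List.map_map, ← List.sum_map_mul_left]
            congr 1
            exact List.map_congr_left fun y hy => h2 y hy
          rw [e1, e2]
          have := mul_le_mul_of_nonneg_left ht hc
          refine this.trans_eq ?_
          change _ = (c * φ t) * _ + _
          ring
        · have e1 : ((xs.map fun x => c ^ (1 / r) • x).map fun x => ‖x‖ ^ r).sum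
              = c * (xs.map fun x => ‖x‖ ^ r).sum := by
            rw [List.map_map, ← List.sum_map_mul_left]
            congr 1
            refine List.map_congr_left fun x _ => ?_
            rw [Function.comp_apply, norm_smul, Real.norm_of_nonneg (by positivity),
              Real.mul_rpow (by positivity) (norm_nonneg _), ← Real.rpow_mul hc,
              one_div_mul_cancel hr.ne', Real.rpow_one]
          have e2 : ((ys.map fun y => c ^ (1 / r) • y).map S).sum = c * (ys.map S).sum := by
            rw [List.map_map, ← List.sum_map_mul_left]
            congr 1
            refine List.map_congr_left fun y _ => ?_
            rw [Function.comp_apply, hS _ _ (by positivity), ← Real.rpow_mul hc,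
              one_div_mul_cancel hr.ne', Real.rpow_one]
          rw [e1, e2, ← mul_sub]
          exact mul_le_mul_of_nonneg_left hs hc }
  -- On `{0} × ℝ` put `f (0, s) = -s`; nonnegativity on the cone is exactly `H`. A nonnegative
  -- extension `g` satisfies `g (φ, 0) ≥ s` for all `(φ, s)` in `C`, and `l φ = g (φ, 0)`.
  let f : (SimpleFunc Ω ℝ × ℝ) →ₗ.[ℝ] ℝ :=
    { domain := LinearMap.ker (LinearMap.fst ℝ (SimpleFunc Ω ℝ) ℝ)
      toFun := -(LinearMap.snd ℝ (SimpleFunc Ω ℝ) ℝ ∘ₗ Submodule.subtype _) }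
  obtain ⟨g, hgf, hg⟩ := riesz_extension C f (by
      rintro ⟨⟨φ, s⟩, hq⟩ ⟨xs, ys, h, hs⟩
      have hφ : φ = 0 := hq
      subst hφ
      have := H xs ys (by filter_upwards [h] with t ht; simpa using ht)
      change 0 ≤ - s
      simp only at hs
      linarith) (by
      rintro ⟨φ, s⟩
      -- Since `φ ≥ -M'`, the single vector `M' ^ (1 / r) • x₀` compensates the negative part of
      -- `φ`; a shift of the second coordinate pays for it.
      obtain ⟨M, hM⟩ := φ.exists_forall_norm_le
      let M' := max M 0
      refine ⟨⟨(0, - ‖M' ^ (1 / r) • x₀‖ ^ r - s), by simp [f]⟩, [M' ^ (1 / r) • x₀], [], ?_, ?_⟩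
      · filter_upwards [hT M' (le_max_right _ _) x₀] with t ht
        simp only [List.map_nil, List.sum_nil, Prod.mk_add_mk, zero_add, List.map_cons,
          List.sum_cons, add_zero]
        rw [ht, ← add_mul]
        refine mul_nonneg ?_ (by positivity)
        have h1 := (hM t).trans (le_max_left M 0)
        rw [Real.norm_eq_abs] at h1
        have := neg_abs_le (φ t)
        linarith
      · simp)
  have hg' : ∀ φ s, g (φ, s) = g (φ, 0) - s := by
    intro φ s
    have h1 : (φ, s) = (φ, (0 : ℝ)) + (0, s) := by simp
    have h2 : g (0, s) = - s := hgf ⟨(0, s), by simp [f]⟩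
    rw [h1, map_add, h2, sub_eq_add_neg]
  refine ⟨g ∘ₗ LinearMap.inl ℝ _ _, fun φ y h => ?_, fun φ x h => ?_⟩
  · have := hg (φ, S y) ⟨[], [y], by simpa using h, by simp⟩
    rw [hg'] at this
    simpa using this
  · have := hg (-φ, - ‖x‖ ^ r) ⟨[x], [], by
      filter_upwards [h] with t ht
      simp only [List.map_nil, List.sum_nil, SimpleFunc.coe_neg, Pi.neg_apply, List.map_cons,
        List.sum_cons, add_zero]
      linarith, by simp⟩
    rw [hg'] at this
    have h3 : g (-φ, 0) = - g (φ, 0) := by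
      rw [← map_neg]; simp
    rw [h3] at this
    simp only [LinearMap.comp_apply, LinearMap.inl_apply]
    linarith

/-- The countably additive part of a positive linear functional on the simple functions. -/
theorem exists_measure_le_linearMap (l : (SimpleFunc Ω ℝ) →ₗ[ℝ] ℝ)
    (hl : ∀ φ : SimpleFunc Ω ℝ, (∀ᵐ t ∂ν, 0 ≤ φ t) → 0 ≤ l φ) :
    ∃ μ : Measure Ω, IsFiniteMeasure μ ∧ μ ≪ ν ∧
      (∀ φ : SimpleFunc Ω ℝ, 0 ≤ φ → ∫ t, φ t ∂μ ≤ l φ) ∧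
      ∀ φ : SimpleFunc Ω ℝ, 0 ≤ φ → ∀ ε : ℝ, 0 < ε → ∃ G : ℕ → Set Ω, Monotone G ∧
        (∀ n, MeasurableSet (G n)) ∧ ⋃ n, G n = Set.univ ∧
        ∀ n, l (φ.restrict (G n)) ≤ ∫ t, φ t ∂μ + ε := by
  classical
  let ind : ∀ s : Set Ω, MeasurableSet s → SimpleFunc Ω ℝ := fun s hs =>
    SimpleFunc.piecewise s hs (SimpleFunc.const Ω 1) (SimpleFunc.const Ω 0)
  have hind : ∀ s hs t, ind s hs t = s.indicator (fun _ => (1 : ℝ)) t := by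
    intro s hs t
    simp only [ind, SimpleFunc.coe_piecewise, SimpleFunc.coe_const, Set.indicator]
    rfl
  have hl0 : ∀ φ : SimpleFunc Ω ℝ, (∀ t, 0 ≤ φ t) → 0 ≤ l φ := fun φ h =>
    hl φ (ae_of_all _ h)
  have hlmono : ∀ φ ψ : SimpleFunc Ω ℝ, (∀ t, φ t ≤ ψ t) → l φ ≤ l ψ := by
    intro φ ψ h
    have := hl0 (ψ - φ) fun t => by simpa using h t
    rw [map_sub] at this
    linarith
  have hind0 : ∀ s hs, 0 ≤ l (ind s hs) := fun s hs => hl0 _ fun t => by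
    rw [hind]; exact Set.indicator_nonneg (fun _ _ => zero_le_one) _
  let m0 : ∀ s : Set Ω, MeasurableSet s → ℝ≥0∞ := fun s hs => ENNReal.ofReal (l (ind s hs))
  let m : Set Ω → ℝ≥0∞ := extend m0
  have hm : ∀ s (hs : MeasurableSet s), m s = ENNReal.ofReal (l (ind s hs)) := fun s hs =>
    extend_eq m0 hs
  have hmtop : ∀ s, ¬ MeasurableSet s → m s = ∞ := fun s hs => extend_eq_top m0 hs
  have hm_empty : m ∅ = 0 := by
    rw [hm ∅ MeasurableSet.empty]
    have : ind ∅ MeasurableSet.empty = 0 := by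
      ext t
      rw [hind]; simp
    rw [this, map_zero, ENNReal.ofReal_zero]
  have hm_union : ∀ s s', MeasurableSet s → MeasurableSet s' → m (s ∪ s') ≤ m s + m s' := by
    intro s s' hs hs'
    rw [hm _ hs, hm _ hs', hm _ (hs.union hs'), ← ENNReal.ofReal_add (hind0 _ _) (hind0 _ _),
      ← map_add]
    refine ENNReal.ofReal_le_ofReal (hlmono _ _ fun t => ?_)
    rw [SimpleFunc.coe_add, Pi.add_apply, hind, hind, hind]
    by_cases h : t ∈ s <;> by_cases h' : t ∈ s' <;> simp [h, h']
  -- The infimum of `∑ m (A i)` over countable covers turns the finitely additive `m` into its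
  -- countably additive part. As `m = ∞` off the measurable sets, only measurable covers count.
  let o : OuterMeasure Ω := OuterMeasure.ofFunction m hm_empty
  have hcar : (inferInstance : MeasurableSpace Ω) ≤ o.caratheodory := by
    intro s hs
    refine OuterMeasure.ofFunction_caratheodory fun t => ?_
    by_cases ht : MeasurableSet t
    · rw [hm _ ht, hm _ (ht.inter hs), hm _ (ht.diff hs),
        ← ENNReal.ofReal_add (hind0 _ _) (hind0 _ _), ← map_add]
      refine ENNReal.ofReal_le_ofReal (hlmono _ _ fun a => ?_)
      rw [SimpleFunc.coe_add, Pi.add_apply, hind, hind, hind]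
      by_cases h : a ∈ s <;> by_cases h' : a ∈ t <;> simp [h, h']
    · rw [hmtop _ ht]
      exact le_top
  let μ : Measure Ω := o.toMeasure hcar
  have hμo : ∀ s, MeasurableSet s → μ s = o s := fun s hs => toMeasure_apply o hcar hs
  have hμm : ∀ s, MeasurableSet s → μ s ≤ m s := fun s hs => by
    rw [hμo s hs]; exact OuterMeasure.ofFunction_le s
  have hμfin : IsFiniteMeasure μ := ⟨(hμm _ MeasurableSet.univ).trans_lt (by
    rw [hm _ MeasurableSet.univ]; exact ENNReal.ofReal_lt_top)⟩
  -- For a null set `s` the function `-1_s` is nonnegative a.e. too, so `l` is at most `0` on `1_s`.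
  have hμν : μ ≪ ν := by
    refine Measure.AbsolutelyContinuous.mk fun s hs h0 => le_antisymm ((hμm s hs).trans ?_) zero_le
    rw [hm s hs, nonpos_iff_eq_zero, ENNReal.ofReal_eq_zero]
    have := hl (-(ind s hs)) (by
      filter_upwards [measure_eq_zero_iff_ae_notMem.1 h0] with t ht
      rw [SimpleFunc.coe_neg, Pi.neg_apply, hind, Set.indicator_of_notMem ht, neg_zero])
    rw [map_neg] at this
    linarith
  have hint : ∀ φ : SimpleFunc Ω ℝ, Integrable φ μ := fun φ => φ.integrable_of_isFiniteMeasure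
  let D : (SimpleFunc Ω ℝ) →ₗ[ℝ] ℝ := l -
    { toFun := fun φ => ∫ t, φ t ∂μ
      map_add' := fun φ ψ => integral_add (hint φ) (hint ψ)
      map_smul' := fun c φ => integral_smul c φ }
  have hD : ∀ φ, D φ = l φ - ∫ t, φ t ∂μ := fun φ => rfl
  have hDind : ∀ s hs, D (ind s hs) = l (ind s hs) - μ.real s := by
    intro s hs
    rw [hD]
    congr 1
    simp_rw [hind]
    rw [integral_indicator hs]
    simp
  -- The remainder `D` is nonnegative on indicators because `μ ≤ m`; induction over `NNReal`-valued
  -- simple functions extends this without leaving the nonnegative coefficients.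
  have hD0 : ∀ φ : SimpleFunc Ω ℝ, 0 ≤ φ → 0 ≤ D φ := by
    have key : ∀ φ : SimpleFunc Ω NNReal, 0 ≤ D (φ.map (fun a : NNReal => (a : ℝ))) := by
      intro φ
      induction φ using SimpleFunc.induction with
      | const c hs =>
        rename_i s
        have : (SimpleFunc.piecewise s hs (SimpleFunc.const Ω c) (SimpleFunc.const Ω 0)).map
            (fun a : NNReal => (a : ℝ)) = (c : ℝ) • ind s hs := by
          ext t
          rw [SimpleFunc.coe_smul, Pi.smul_apply, hind]
          by_cases h : t ∈ s <;> simp [h]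
        rw [this, map_smul, hDind]
        refine mul_nonneg c.2 (sub_nonneg.2 ?_)
        have := hμm s hs
        rw [hm s hs] at this
        exact ENNReal.toReal_le_of_le_ofReal (hind0 _ _) this
      | add hdisj hf hg =>
        rename_i f g
        have : (f + g).map (fun a : NNReal => (a : ℝ)) = f.map (fun a : NNReal => (a : ℝ))
            + g.map (fun a : NNReal => (a : ℝ)) := by
          ext t; simp
        rw [this, map_add]
        exact add_nonneg hf hg
    intro φ hφ
    have : φ = (φ.map Real.toNNReal).map (fun a : NNReal => (a : ℝ)) := by
      ext t
      simp only [SimpleFunc.map_apply]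
      rw [Real.coe_toNNReal _ (hφ t)]
    rw [this]
    exact key _
  refine ⟨μ, hμfin, hμν, fun φ hφ => ?_, fun φ hφ ε hε => ?_⟩
  · have := hD0 φ hφ
    rw [hD] at this
    linarith
  obtain ⟨M, hM⟩ := φ.exists_forall_norm_le
  obtain ⟨δ, hδ, hδε⟩ : ∃ δ : ℝ, 0 < δ ∧ max M 0 * δ ≤ ε := by
    refine ⟨ε / (max M 0 + 1), by positivity, ?_⟩
    rw [mul_div_assoc', div_le_iff₀ (by positivity)]
    nlinarith [le_max_right M 0]
  obtain ⟨A, hAcov, hAsum⟩ : ∃ A : ℕ → Set Ω, Set.univ ⊆ ⋃ i, A i ∧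
      ∑' i, m (A i) < μ Set.univ + ENNReal.ofReal δ := by
    have h1 : o Set.univ < μ Set.univ + ENNReal.ofReal δ := by
      rw [← hμo _ MeasurableSet.univ]
      exact ENNReal.lt_add_right (measure_ne_top _ _) (by simpa using hδ)
    rw [OuterMeasure.ofFunction_apply] at h1
    simp only [iInf_lt_iff] at h1
    obtain ⟨A, hA, h⟩ := h1
    exact ⟨A, hA, h⟩
  have hAmeas : ∀ i, MeasurableSet (A i) := by
    intro i
    by_contra hi
    have : m (A i) ≤ ∑' i, m (A i) := ENNReal.le_tsum i
    rw [hmtop _ hi, top_le_iff] at this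
    rw [this] at hAsum
    exact absurd hAsum (by simp)
  let G : ℕ → Set Ω := fun n => ⋃ i ∈ Finset.range n, A i
  have hGmeas : ∀ n, MeasurableSet (G n) := fun n =>
    Finset.measurableSet_biUnion _ fun i _ => hAmeas i
  have hGm : ∀ n, m (G n) ≤ ∑ i ∈ Finset.range n, m (A i) := by
    intro n
    induction n with
    | zero => simp [G, hm_empty]
    | succ n ih =>
      have : G (n + 1) = G n ∪ A n := by
        ext t
        simp only [G, Set.mem_iUnion, Finset.mem_range, Set.mem_union, exists_prop]
        constructor
        · rintro ⟨i, hi, hit⟩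
          rcases (Nat.lt_succ_iff_lt_or_eq.1 hi) with h | rfl
          · exact Or.inl ⟨i, h, hit⟩
          · exact Or.inr hit
        · rintro (⟨i, hi, hit⟩ | h)
          · exact ⟨i, hi.trans (Nat.lt_succ_self n), hit⟩
          · exact ⟨n, Nat.lt_succ_self n, h⟩
      rw [this, Finset.sum_range_succ]
      exact (hm_union _ _ (hGmeas n) (hAmeas n)).trans (by gcongr)
  -- The total excess of the cover `A` over `μ` is below `δ`, and discarding the tail only lowers
  -- it, since `μ ≤ m` there. In `ℝ≥0∞` the finite `μ univ` is added to both sides and cancelled in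
  -- place of a subtraction.
  have hGδ : ∀ n, D (ind (G n) (hGmeas n)) ≤ δ := by
    intro n
    have h1 : μ Set.univ ≤ μ (G n) + ∑' i, m (A (i + n)) := by
      have hsub : Set.univ ⊆ G n ∪ ⋃ i, A (i + n) := by
        intro t ht
        obtain ⟨i, hi⟩ := Set.mem_iUnion.1 (hAcov ht)
        rcases lt_or_ge i n with h | h
        · exact Or.inl (Set.mem_biUnion (Finset.mem_coe.2 (Finset.mem_range.2 h)) hi)
        · exact Or.inr (Set.mem_iUnion.2 ⟨i - n, by rwa [Nat.sub_add_cancel h]⟩)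
      calc μ Set.univ ≤ μ (G n ∪ ⋃ i, A (i + n)) := measure_mono hsub
        _ ≤ μ (G n) + μ (⋃ i, A (i + n)) := measure_union_le _ _
        _ ≤ μ (G n) + ∑' i, m (A (i + n)) := by
            gcongr
            exact (measure_iUnion_le _).trans (ENNReal.tsum_le_tsum fun i => hμm _ (hAmeas _))
    have h2 : m (G n) + μ Set.univ ≤ (μ (G n) + ENNReal.ofReal δ) + μ Set.univ := by
      calc m (G n) + μ Set.univ
          ≤ ∑ i ∈ Finset.range n, m (A i) + (μ (G n) + ∑' i, m (A (i + n))) :=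
            add_le_add (hGm n) h1
        _ = μ (G n) + (∑ i ∈ Finset.range n, m (A i) + ∑' i, m (A (i + n))) := by ring
        _ = μ (G n) + ∑' i, m (A i) := by
            rw [ENNReal.summable.sum_add_tsum_nat_add']
        _ ≤ μ (G n) + (μ Set.univ + ENNReal.ofReal δ) := by gcongr
        _ = _ := by ring
    have h3 := ENNReal.le_of_add_le_add_right (measure_ne_top μ Set.univ) h2
    rw [hm _ (hGmeas n), ← ENNReal.ofReal_toReal (measure_ne_top μ (G n)),
      ← ENNReal.ofReal_add ENNReal.toReal_nonneg hδ.le,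
      ENNReal.ofReal_le_ofReal_iff (by positivity)] at h3
    rw [hDind, Measure.real]
    linarith
  refine ⟨G, ?_, hGmeas, ?_, fun n => ?_⟩
  · intro a b hab
    exact Set.biUnion_subset_biUnion_left (by simpa using hab)
  · refine Set.eq_univ_of_univ_subset fun t ht => ?_
    obtain ⟨i, hi⟩ := Set.mem_iUnion.1 (hAcov ht)
    exact Set.mem_iUnion.2 ⟨i + 1, Set.mem_biUnion
      (Finset.mem_coe.2 (Finset.mem_range.2 (Nat.lt_succ_self i))) hi⟩
  -- As `φ ≤ max M 0`, the remainder of `φ` restricted to `G n` is at most `max M 0 * δ ≤ ε`.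
  · have h1 := hD0 (max M 0 • ind (G n) (hGmeas n) - φ.restrict (G n)) (by
      intro t
      simp only [SimpleFunc.coe_sub, SimpleFunc.coe_smul, Pi.sub_apply, Pi.smul_apply, smul_eq_mul,
        SimpleFunc.restrict_apply φ (hGmeas n), hind]
      by_cases h : t ∈ G n
      · simpa [h] using Or.inl ((le_abs_self _).trans (hM t))
      · simp [h])
    rw [map_sub, map_smul, smul_eq_mul] at h1
    have h2 : max M 0 * D (ind (G n) (hGmeas n)) ≤ max M 0 * δ :=
      mul_le_mul_of_nonneg_left (hGδ n) (le_max_right _ _)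
    have h3 : ∫ t, φ.restrict (G n) t ∂μ ≤ ∫ t, φ t ∂μ := by
      refine integral_mono (hint _) (hint _) fun t => ?_
      rw [SimpleFunc.restrict_apply φ (hGmeas n)]
      exact Set.indicator_le_self' (fun _ _ => hφ t) t
    have h4 := hD (φ.restrict (G n))
    linarith

end FunctionSpace

/-! ### Pointwise calculus in `L₀(ν)`, norm limits in `Y(ν)`, and maximal supports -/

section FunctionSpace

variable {Ω : Type*} [MeasurableSpace Ω] {ν : Measure Ω}

theorem coeFn_l0Pow (f : Ω →ₘ[ν] ℝ) (s : ℝ) : l0Pow f s =ᵐ[ν] fun t => f t ^ s :=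
  AEEqFun.coeFn_compMeasurable _ _ _

theorem coeFn_l0Sum (r : ℝ) {n : ℕ} (x : Fin n → (Ω →ₘ[ν] ℝ)) :
    l0Sum r x =ᵐ[ν] fun t => (∑ k, |x k t| ^ r) ^ (1 / r) := by
  have h : ∀ᵐ t ∂ν, ∀ k, l0Pow |x k| r t = |x k t| ^ r := by
    rw [ae_all_iff]
    intro k
    filter_upwards [coeFn_l0Pow |x k| r, AEEqFun.coeFn_abs (x k)] with t h1 h2
    rw [h1, h2]
  filter_upwards [coeFn_l0Pow (∑ k, l0Pow |x k| r) (1 / r),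
    AEEqFun.coeFn_finsetSum Finset.univ (fun k => l0Pow |x k| r), h] with t h1 h2 h3
  rw [l0Sum, h1, h2]
  simp [h3]

theorem l0_nonneg_iff {y : Ω →ₘ[ν] ℝ} : 0 ≤ y ↔ ∀ᵐ t ∂ν, 0 ≤ y t := by
  rw [← AEEqFun.coeFn_le]
  constructor <;> intro h
  · filter_upwards [h, AEEqFun.coeFn_zero (β := ℝ) (μ := ν)] with t h1 h2
    rwa [h2] at h1
  · filter_upwards [h, AEEqFun.coeFn_zero (β := ℝ) (μ := ν)] with t h1 h2
    rwa [h2]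

theorem l0_le_of_map_sub_nonneg {X : Type*} [AddCommGroup X] [Module ℝ X]
    {T : X →ₗ[ℝ] (Ω →ₘ[ν] ℝ)} {x y : X} (h : 0 ≤ T (y - x)) : ∀ᵐ t ∂ν, T x t ≤ T y t := by
  rw [map_sub, l0_nonneg_iff] at h
  filter_upwards [h, AEEqFun.coeFn_sub (T y) (T x)] with t h1 h2
  rw [h2, Pi.sub_apply] at h1
  linarith

/-- The pointwise counterpart of `latticeSum_map_le`: only the countably many `a ∈ D` have to be
tested, which leaves one null set. -/
theorem ae_l0Sum_map_le {E : Type*} [NormedAddCommGroup E] [Lattice E] [HasSolidNorm E]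
    [IsOrderedAddMonoid E] [NormedSpace ℝ E] [IsOrderedModule ℝ E] [CompleteSpace E]
    {r : ℝ} (hr : 1 ≤ r) {T : E →ₗ[ℝ] (Ω →ₘ[ν] ℝ)} (hT : ∀ x, 0 ≤ x → 0 ≤ T x) {n : ℕ}
    (x : Fin n → E) :
    ∀ᵐ t ∂ν, (∑ k, |T (x k) t| ^ r) ^ (1 / r) ≤ T (latticeSum r x) t := by
  obtain ⟨D, hDc, hDs, hD⟩ := exists_countable_forall_rpow_sum_le hr n
  have h : ∀ᵐ t ∂ν, ∀ a ∈ D, ∑ k, a k * T (x k) t ≤ T (latticeSum r x) t := by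
    rw [ae_ball_iff hDc]
    intro a ha
    have h1 : ∀ᵐ t ∂ν, ∀ k, (a k • T (x k) : Ω →ₘ[ν] ℝ) t = a k * T (x k) t := by
      rw [ae_all_iff]
      intro k
      filter_upwards [AEEqFun.coeFn_smul (a k) (T (x k))] with t ht
      rw [ht, Pi.smul_apply, smul_eq_mul]
    filter_upwards [l0_le_of_map_sub_nonneg
      (hT _ (sub_nonneg.2 (sum_smul_le_latticeSum (hDs ha) x))), h1,
      AEEqFun.coeFn_finsetSum Finset.univ (fun k => a k • T (x k))] with t h2 h3 h4
    simp only [map_sum, map_smul] at h2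
    rw [h4] at h2
    simpa [h3] using h2
  filter_upwards [h] with t ht
  exact hD _ _ ht

namespace BanachFunctionSpace

variable (Y : BanachFunctionSpace ν)

theorem nrm_le_of_ae {y z : Ω →ₘ[ν] ℝ} (h : ∀ᵐ t ∂ν, |y t| ≤ |z t|) : Y.nrm y ≤ Y.nrm z := by
  refine Y.nrm_mono _ _ (AEEqFun.coeFn_le.1 ?_)
  filter_upwards [h, AEEqFun.coeFn_abs y, AEEqFun.coeFn_abs z] with t h1 h2 h3
  rwa [h2, h3]

theorem nrm_sub_le (y z : Ω →ₘ[ν] ℝ) : Y.nrm (y - z) ≤ Y.nrm y + Y.nrm z := by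
  have h := Y.nrm_smul (-1) z
  rw [sub_eq_add_neg]
  refine (Y.nrm_add_le _ _).trans_eq ?_
  rw [← neg_one_smul ℝ z, h]
  simp

theorem nrm_mk_mul_lt_top {w : Ω →ₘ[ν] ℝ} (hw : Y.nrm w < ∞) (ψ : SimpleFunc Ω ℝ) :
    Y.nrm (AEEqFun.mk ψ ψ.aestronglyMeasurable * w) < ∞ := by
  obtain ⟨M, hM⟩ := ψ.exists_forall_norm_le
  refine lt_of_le_of_lt (Y.nrm_le_of_ae (z := M • w) ?_) ?_
  · filter_upwards [AEEqFun.coeFn_mul (AEEqFun.mk ψ ψ.aestronglyMeasurable) w,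
      AEEqFun.coeFn_mk (μ := ν) ψ ψ.aestronglyMeasurable, AEEqFun.coeFn_smul M w] with t h1 h2 h3
    rw [h1, h3, Pi.mul_apply, h2, Pi.smul_apply, smul_eq_mul, abs_mul, abs_mul]
    exact mul_le_mul_of_nonneg_right ((hM t).trans (le_abs_self _)) (abs_nonneg _)
  · rw [Y.nrm_smul]
    exact ENNReal.mul_lt_top ENNReal.ofReal_lt_top hw

/-- For a monotone sequence in `Y(ν)` which converges in norm the norm limit dominates every
function below the pointwise supremum. -/
theorem nrm_le_of_cauchy {y : ℕ → (Ω →ₘ[ν] ℝ)} {z : Ω →ₘ[ν] ℝ} (hy : ∀ i, Y.nrm (y i) < ∞)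
    (hmono : ∀ i j, i ≤ j → ∀ᵐ t ∂ν, y i t ≤ y j t)
    (hcau : ∀ ε : ℝ≥0∞, 0 < ε → ∃ N, ∀ i ≥ N, ∀ j ≥ N, Y.nrm (y i - y j) ≤ ε)
    (hz0 : ∀ᵐ t ∂ν, 0 ≤ z t) (hz : ∀ᵐ t ∂ν, Tendsto (fun i => y i t) atTop (𝓝 (z t)))
    {C : ℝ≥0∞} (hC : ∀ i, Y.nrm (y i) ≤ C) : Y.nrm z ≤ C := by
  -- The Fatou property presupposes `nrm z < ∞`, which is part of the claim here; the norm limit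
  -- `z'` replaces it.
  obtain ⟨z', -, hlim⟩ := Y.complete y hy hcau
  have hle : ∀ i, ∀ᵐ t ∂ν, y i t ≤ z' t := by
    intro i
    -- For `j ≥ i` the positive part of `y i - z'` is below `|y j - z'|`, whose norm tends to `0`.
    have h0 : Y.nrm ((y i - z') ⊔ 0) = 0 := by
      refine le_antisymm (ge_of_tendsto hlim ?_) zero_le
      filter_upwards [eventually_ge_atTop i] with j hij
      refine Y.nrm_le_of_ae ?_
      filter_upwards [hmono i j hij, AEEqFun.coeFn_sup (y i - z') 0, AEEqFun.coeFn_sub (y i) z',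
        AEEqFun.coeFn_sub (y j) z', AEEqFun.coeFn_zero (β := ℝ) (μ := ν)] with t h1 h2 h3 h4 h5
      rw [h2, h3, h4, h5]
      simp only [Pi.sub_apply, Pi.zero_apply]
      rw [abs_of_nonneg le_sup_right]
      refine sup_le ?_ (abs_nonneg _)
      exact (sub_le_sub_right h1 _).trans (le_abs_self _)
    rw [Y.nrm_eq_zero] at h0
    filter_upwards [AEEqFun.coeFn_sup (y i - z') 0, AEEqFun.coeFn_sub (y i) z',
      AEEqFun.coeFn_zero (β := ℝ) (μ := ν)] with t h2 h3 h5
    rw [h0, h3, h5] at h2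
    simp only [Pi.sub_apply, Pi.zero_apply] at h2
    have : y i t - z' t ≤ 0 := h2 ▸ le_sup_left
    linarith
  have hzz : Y.nrm z ≤ Y.nrm z' := by
    refine Y.nrm_le_of_ae ?_
    filter_upwards [ae_all_iff.2 hle, hz0, hz] with t h1 h2 h3
    rw [abs_of_nonneg h2]
    exact (le_of_tendsto' h3 h1).trans (le_abs_self _)
  have hz' : ∀ i, Y.nrm z' ≤ C + Y.nrm (y i - z') := by
    intro i
    calc Y.nrm z' = Y.nrm (y i - (y i - z')) := by rw [sub_sub_cancel]
      _ ≤ Y.nrm (y i) + Y.nrm (y i - z') := Y.nrm_sub_le _ _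
      _ ≤ _ := by gcongr; exact hC i
  refine hzz.trans (ge_of_tendsto' (f := fun i => C + Y.nrm (y i - z')) (x := atTop) ?_ hz')
  simpa using tendsto_const_nhds.add hlim

end BanachFunctionSpace

/-- For a positive operator the supports of all `T x` are contained in that of a single `T x₀`. -/
theorem exists_nonneg_forall_ae_eq_zero [SigmaFinite ν] {E : Type*} [NormedAddCommGroup E]
    [Lattice E] [HasSolidNorm E]
    [IsOrderedAddMonoid E] [NormedSpace ℝ E] [IsOrderedModule ℝ E] [CompleteSpace E]
    {T : E →ₗ[ℝ] (Ω →ₘ[ν] ℝ)} (hT : ∀ x, 0 ≤ x → 0 ≤ T x) :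
    ∃ x₀ : E, 0 ≤ x₀ ∧ ∀ x, ∀ᵐ t ∂ν, T x₀ t = 0 → T x t = 0 := by
  -- A finite measure with the null sets of `ν` measures the supports by real numbers; a support of
  -- maximal measure is sought.
  obtain ⟨ρ, hρ, hνρ, hρν⟩ := exists_isFiniteMeasure_absolutelyContinuous ν
  let s : E → Set Ω := fun x => {t | T x t ≠ 0}
  have hs : ∀ x, MeasurableSet (s x) := fun x =>
    (measurableSet_eq_fun (T x).measurable measurable_const).compl
  have hmono : ∀ x y, 0 ≤ x → x ≤ y → ∀ᵐ t ∂ν, T x t ≠ 0 → T y t ≠ 0 := by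
    intro x y hx hxy
    filter_upwards [l0_nonneg_iff.1 (hT x hx), l0_le_of_map_sub_nonneg (hT _ (sub_nonneg.2 hxy))]
      with t h1 h2 h3
    exact ((h1.lt_of_ne (Ne.symm h3)).trans_le h2).ne'
  let P : Set ℝ := (fun x => ρ.real (s x)) '' {x | 0 ≤ x}
  have hPb : BddAbove P := ⟨ρ.real Set.univ, by
    rintro _ ⟨x, -, rfl⟩
    exact measureReal_mono (Set.subset_univ _)⟩
  have hPne : P.Nonempty := ⟨_, 0, le_rfl, rfl⟩
  obtain ⟨p, -, hplim, hp⟩ := exists_seq_tendsto_sSup hPne hPb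
  choose x hx0 hxp using hp
  -- The factors make `∑ c n • x n` converge absolutely. Its sum dominates each positive multiple `c
  -- n • x n`, so the support of its image contains that of every `T (x n)` up to null sets, and the
  -- supremum is attained.
  let c : ℕ → ℝ := fun n => (1 / 2) ^ n * (‖x n‖ + 1)⁻¹
  have hc : ∀ n, 0 < c n := fun n => by positivity
  have hsum : Summable fun n => c n • x n := by
    refine Summable.of_norm_bounded summable_geometric_two fun n => ?_
    rw [norm_smul, Real.norm_of_nonneg (hc n).le, mul_assoc]
    refine mul_le_of_le_one_right (by positivity) ?_
    rw [inv_mul_le_iff₀ (by positivity)]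
    linarith
  have hterm : ∀ n, 0 ≤ c n • x n := fun n => smul_nonneg (hc n).le (hx0 n)
  let x₀ : E := ∑' n, c n • x n
  have hx₀ : 0 ≤ x₀ := tsum_nonneg hterm
  have hle : ∀ n, c n • x n ≤ x₀ := fun n => hsum.le_tsum n fun j _ => hterm j
  have hmax : ∀ y, x₀ ≤ y → ρ.real (s y) ≤ ρ.real (s x₀) := by
    intro y hy
    refine (le_csSup hPb ⟨y, hx₀.trans hy, rfl⟩).trans (le_of_tendsto' hplim fun n => ?_)
    rw [← hxp n]
    refine ENNReal.toReal_mono (measure_ne_top _ _) (measure_mono_ae ?_)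
    refine hρν.ae_le ?_
    filter_upwards [hmono _ _ (hterm n) (hle n), AEEqFun.coeFn_smul (c n) (T (x n))] with t h1 h2 h3
    refine h1 ?_
    rw [map_smul, h2, Pi.smul_apply, smul_eq_mul]
    exact mul_ne_zero (hc n).ne' h3
  refine ⟨x₀, hx₀, fun z => ?_⟩
  have hsub : s x₀ ≤ᵐ[ρ] s (x₀ + |z|) := by
    refine hρν.ae_le ?_
    filter_upwards [hmono x₀ (x₀ + |z|) hx₀ (le_add_of_nonneg_right (abs_nonneg z))] with t ht
    exact ht
  -- By maximality adding `|z|` does not enlarge the support, while `|T z| ≤ T (x₀ + |z|)`.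
  have heq : s x₀ =ᵐ[ρ] s (x₀ + |z|) := by
    refine ae_eq_of_ae_subset_of_measure_ge hsub ?_ (hs _).nullMeasurableSet (measure_ne_top _ _)
    have := hmax (x₀ + |z|) (le_add_of_nonneg_right (abs_nonneg z))
    exact (ENNReal.toReal_le_toReal (measure_ne_top _ _) (measure_ne_top _ _)).1 this
  have hz1 := l0_le_of_map_sub_nonneg (hT (x₀ + |z| - z) (sub_nonneg.2
    ((le_abs_self z).trans (le_add_of_nonneg_left hx₀))))
  have hz2 := l0_le_of_map_sub_nonneg (hT (x₀ + |z| - (-z)) (sub_nonneg.2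
    ((neg_le_abs z).trans (le_add_of_nonneg_left hx₀))))
  filter_upwards [hνρ.ae_le heq, hz1, hz2, AEEqFun.coeFn_neg (T z)]
    with t h1 h2 h3 h4 h5
  have h6 : T (x₀ + |z|) t = 0 := by
    by_contra hne
    exact (h1.symm.le hne) h5
  rw [h6] at h2 h3
  rw [map_neg, h4, Pi.neg_apply] at h3
  linarith

end FunctionSpace

/-! ### From `r`-convexity of `E` to the weighted inequality -/

section FunctionSpace

variable {Ω : Type*} [MeasurableSpace Ω] {ν : Measure Ω}

variable {E : Type*} [NormedAddCommGroup E]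
    [Lattice E] [HasSolidNorm E]
    [IsOrderedAddMonoid E] [NormedSpace ℝ E] [IsOrderedModule ℝ E] [CompleteSpace E]

/-- `T (latticeSum r x)` dominates `(∑ |y j| ^ r) ^ (1 / r)`. Concavity of `Y` bounds the left side
from below, boundedness of `T` and convexity of `E` bound the norm of `T (latticeSum r x)` from
above. This is the compatibility condition for the separation argument. -/
theorem IsRConvexLattice.exists_forall_sum_nrm_rpow_le {r : ℝ} (hr : 1 ≤ r)
    (hE : IsRConvexLattice E r) {Y : BanachFunctionSpace ν} (hY : Y.IsRConcave r)
    {T : E →ₗ[ℝ] (Ω →ₘ[ν] ℝ)} (hTY : Y.IsOperatorInto T) (hT : ∀ x, 0 ≤ x → 0 ≤ T x) :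
    ∃ K : ℝ, 0 < K ∧ ∀ (n : ℕ) (x : Fin n → E) (m : ℕ) (y : Fin m → (Ω →ₘ[ν] ℝ)),
      (∀ᵐ t ∂ν, ∑ j, |y j t| ^ r ≤ ∑ k, |T (x k) t| ^ r) →
      ∑ j, (Y.nrm (y j)).toReal ^ r ≤ K * ∑ k, ‖x k‖ ^ r := by
  have hr0 : 0 < r := by linarith
  obtain ⟨c, hc, hE⟩ := hE
  obtain ⟨c', hc', hY⟩ := hY
  obtain ⟨d, hd, hTY⟩ := hTY
  -- The summand `1` only serves to make the constant invertible.
  refine ⟨(c' * (d * c)) ^ r + 1, by positivity, fun n x m y h => ?_⟩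
  have hz := ae_l0Sum_map_le hr hT x
  set z := latticeSum r x with hzdef
  have hyz : ∀ᵐ t ∂ν, (∑ j, |y j t| ^ r) ^ (1 / r) ≤ T z t := by
    filter_upwards [h, hz] with t h1 h2
    exact (Real.rpow_le_rpow (by positivity) h1 (by positivity)).trans h2
  have hfin : ∀ j, Y.nrm (y j) < ∞ := by
    intro j
    refine lt_of_le_of_lt (Y.nrm_le_of_ae (z := T z) ?_)
      ((hTY z).trans_lt ENNReal.ofReal_lt_top)
    filter_upwards [hyz] with t ht
    refine le_trans ?_ (ht.trans (le_abs_self _))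
    calc |y j t| = (|y j t| ^ r) ^ (1 / r) := by
          rw [← Real.rpow_mul (abs_nonneg _), mul_one_div_cancel hr0.ne', Real.rpow_one]
      _ ≤ _ := by
          refine Real.rpow_le_rpow (by positivity) ?_ (by positivity)
          exact Finset.single_le_sum (f := fun j => |y j t| ^ r) (fun i _ => by positivity)
            (Finset.mem_univ j)
  have h1 : Y.nrm (l0Sum r y) ≤ ENNReal.ofReal (d * ‖z‖) := by
    refine (Y.nrm_le_of_ae (z := T z) ?_).trans (hTY z)
    filter_upwards [hyz, coeFn_l0Sum r y] with t ht h2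
    rw [h2, abs_of_nonneg (by positivity)]
    exact ht.trans (le_abs_self _)
  set A := ∑ j, (Y.nrm (y j)).toReal ^ r with hA
  set B := ∑ k, ‖x k‖ ^ r with hB
  have hA0 : 0 ≤ A := by positivity
  have hB0 : 0 ≤ B := by positivity
  have h2 : ENNReal.ofReal (A ^ (1 / r)) ≤ ENNReal.ofReal (c' * (d * ‖z‖)) := by
    have e : ∑ j, Y.nrm (y j) ^ r = ENNReal.ofReal A := by
      rw [hA, ENNReal.ofReal_sum_of_nonneg fun j _ => by positivity]
      refine Finset.sum_congr rfl fun j _ => ?_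
      rw [← ENNReal.ofReal_rpow_of_nonneg ENNReal.toReal_nonneg hr0.le,
        ENNReal.ofReal_toReal (hfin j).ne]
    have := hY m y hfin
    rw [e, ENNReal.ofReal_rpow_of_nonneg hA0 (by positivity)] at this
    refine this.trans ?_
    rw [ENNReal.ofReal_mul hc']
    gcongr
  rw [ENNReal.ofReal_le_ofReal_iff (by positivity)] at h2
  have h3 : A ^ (1 / r) ≤ c' * (d * c) * B ^ (1 / r) := by
    refine h2.trans ?_
    have := hE n x
    calc c' * (d * ‖z‖) ≤ c' * (d * (c * B ^ (1 / r))) := by gcongr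
      _ = _ := by ring
  calc A = (A ^ (1 / r)) ^ r := by
        rw [← Real.rpow_mul hA0, one_div_mul_cancel hr0.ne', Real.rpow_one]
    _ ≤ (c' * (d * c) * B ^ (1 / r)) ^ r := Real.rpow_le_rpow (by positivity) h3 hr0.le
    _ = (c' * (d * c)) ^ r * B := by
        rw [Real.mul_rpow (by positivity) (by positivity), ← Real.rpow_mul hB0,
          one_div_mul_cancel hr0.ne', Real.rpow_one]
    _ ≤ _ := by nlinarith

/-- The separation is applied with `S y = K⁻¹ * ‖y‖ ^ r`, and `l` is replaced by its countably
additive part `μ`. The upper estimate survives because `μ ≤ l`; the lower one needs the Fatou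
property. -/
theorem IsRConvexLattice.exists_measure {r : ℝ} (hr : 1 ≤ r)
    (hE : IsRConvexLattice E r) {Y : BanachFunctionSpace ν} (hY : Y.IsRConcave r)
    {T : E →ₗ[ℝ] (Ω →ₘ[ν] ℝ)} (hTY : Y.IsOperatorInto T) (hT : ∀ x, 0 ≤ x → 0 ≤ T x)
    {x₀ : E} (hx₀ : 0 ≤ x₀) :
    ∃ (K : ℝ) (μ : Measure Ω), IsFiniteMeasure μ ∧ μ ≪ ν ∧
      (∀ ψ : SimpleFunc Ω ℝ, 0 ≤ ψ → Y.nrm (AEEqFun.mk ψ ψ.aestronglyMeasurable * T x₀) ^ r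
        ≤ ENNReal.ofReal K * ∫⁻ t, ENNReal.ofReal (ψ t) ^ r ∂μ) ∧
      ∀ x, ∫⁻ t, ENNReal.ofReal (|T x t| ^ r / |T x₀ t| ^ r) ∂μ ≤ ENNReal.ofReal (‖x‖ ^ r) := by
  have hr0 : 0 < r := by linarith
  obtain ⟨K, hK, hKle⟩ := hE.exists_forall_sum_nrm_rpow_le hr hY hTY hT
  obtain ⟨l, hl1, hl2⟩ := exists_linearMap_simpleFunc hr0 T x₀
    (fun y => K⁻¹ * (Y.nrm y).toReal ^ r) (by
      intro c y hc
      rw [Y.nrm_smul, ENNReal.toReal_mul, ENNReal.toReal_ofReal (abs_nonneg _), abs_of_nonneg hc,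
        Real.mul_rpow hc ENNReal.toReal_nonneg]
      ring) (by
      intro xs ys h
      have := hKle xs.length (fun k => xs[k.1]) ys.length (fun k => ys[k.1]) (by
        filter_upwards [h] with t ht
        rw [Fin.sum_univ_fun_getElem ys (fun y => |y t| ^ r),
          Fin.sum_univ_fun_getElem xs (fun x => |T x t| ^ r)]
        exact ht)
      rw [Fin.sum_univ_fun_getElem ys (fun y => (Y.nrm y).toReal ^ r),
        Fin.sum_univ_fun_getElem xs (fun x => ‖x‖ ^ r)] at this
      rw [List.sum_map_mul_left, inv_mul_le_iff₀ hK]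
      exact this)
  have hS0 : ∀ y, 0 ≤ K⁻¹ * (Y.nrm y).toReal ^ r := fun y => by positivity
  obtain ⟨μ, hμ, hμν, hμl, hμG⟩ := exists_measure_le_linearMap (ν := ν) l (by
    intro φ hφ
    refine (hS0 0).trans (hl1 φ 0 ?_)
    filter_upwards [hφ, AEEqFun.coeFn_zero (β := ℝ) (μ := ν)] with t h1 h2
    rw [h2, Pi.zero_apply, abs_zero, Real.zero_rpow hr0.ne']
    positivity)
  have hwfin : Y.nrm (T x₀) < ∞ := by
    obtain ⟨d, hd, hTY⟩ := hTY
    exact (hTY x₀).trans_lt ENNReal.ofReal_lt_top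
  have hw0 := l0_nonneg_iff.1 (hT x₀ hx₀)
  refine ⟨K, μ, hμ, hμν, fun ψ hψ => ?_, fun x => ?_⟩
  · let φ : SimpleFunc Ω ℝ := ψ.map fun a => a ^ r
    have hφ : 0 ≤ φ := fun t => Real.rpow_nonneg (hψ t) r
    let F : SimpleFunc Ω ℝ → (Ω →ₘ[ν] ℝ) := fun ψ =>
      AEEqFun.mk ψ ψ.aestronglyMeasurable * T x₀
    have hF : ∀ ψ, F ψ =ᵐ[ν] fun t => ψ t * T x₀ t := by
      intro ψ
      filter_upwards [AEEqFun.coeFn_mul (AEEqFun.mk ψ ψ.aestronglyMeasurable) (T x₀),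
        AEEqFun.coeFn_mk (μ := ν) ψ ψ.aestronglyMeasurable] with t h1 h2
      rw [h1, Pi.mul_apply, h2]
    have hFfin : Y.nrm (F ψ) < ∞ := Y.nrm_mk_mul_lt_top hwfin ψ
    -- On `G n` the chain is `K⁻¹ * ‖ψ 1_{G n} T x₀‖ ^ r ≤ l (ψ ^ r 1_{G n}) ≤ ∫ ψ ^ r dμ + ε`; the
    -- norms on the left converge as `G n` increases to `Ω`.
    have key : ∀ ε : ℝ, 0 < ε → K⁻¹ * (Y.nrm (F ψ)).toReal ^ r ≤ ∫ t, φ t ∂μ + ε := by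
      intro ε hε
      obtain ⟨G, hGmono, hGmeas, hGuniv, hG⟩ := hμG φ hφ ε hε
      have hres : ∀ n t, ψ.restrict (G n) t = (G n).indicator ψ t := fun n t => by
        rw [SimpleFunc.restrict_apply _ (hGmeas n)]
      have hlim := Y.fatou (fun n => F (ψ.restrict (G n))) (F ψ) hFfin (fun n => by
          rw [l0_nonneg_iff]
          filter_upwards [hF (ψ.restrict (G n)), hw0] with t h1 h2
          rw [h1, hres]
          exact mul_nonneg (Set.indicator_nonneg (fun t _ => hψ t) _) h2) (by
          intro i j hij
          refine AEEqFun.coeFn_le.1 ?_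
          filter_upwards [hF (ψ.restrict (G i)), hF (ψ.restrict (G j)), hw0] with t h1 h2 h3
          rw [h1, h2, hres, hres]
          refine mul_le_mul_of_nonneg_right ?_ h3
          exact Set.indicator_le_indicator_of_subset (hGmono hij) (fun t => hψ t) t) (by
          have : ∀ᵐ t ∂ν, ∀ n, F (ψ.restrict (G n)) t = ψ.restrict (G n) t * T x₀ t :=
            ae_all_iff.2 fun n => hF _
          filter_upwards [this, hF ψ] with t h1 h2
          obtain ⟨N, hN⟩ := Set.mem_iUnion.1 (hGuniv ▸ Set.mem_univ t : t ∈ ⋃ n, G n)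
          refine tendsto_const_nhds.congr' ?_
          filter_upwards [eventually_ge_atTop N] with n hn
          rw [h1, h2, hres, Set.indicator_of_mem (hGmono hn hN)])
      have hlim' : Tendsto (fun n => K⁻¹ * (Y.nrm (F (ψ.restrict (G n)))).toReal ^ r) atTop
          (𝓝 (K⁻¹ * (Y.nrm (F ψ)).toReal ^ r)) := by
        refine Tendsto.const_mul _ (Tendsto.rpow_const ?_ (Or.inr hr0.le))
        exact (ENNReal.tendsto_toReal hFfin.ne).comp hlim
      refine le_of_tendsto' hlim' fun n => (hl1 (φ.restrict (G n)) _ ?_).trans (hG n)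
      filter_upwards [hF (ψ.restrict (G n))] with t h1
      rw [h1, hres, SimpleFunc.restrict_apply _ (hGmeas n), abs_mul,
        Real.mul_rpow (abs_nonneg _) (abs_nonneg _)]
      refine mul_le_mul_of_nonneg_right (le_of_eq ?_) (by positivity)
      by_cases h : t ∈ G n
      · rw [Set.indicator_of_mem h, Set.indicator_of_mem h, abs_of_nonneg (hψ t)]
        rfl
      · rw [Set.indicator_of_notMem h, Set.indicator_of_notMem h, abs_zero, Real.zero_rpow hr0.ne']
    have key2 := le_of_forall_pos_le_add key
    rw [inv_mul_le_iff₀ hK] at key2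
    have e1 : ENNReal.ofReal (∫ t, φ t ∂μ) = ∫⁻ t, ENNReal.ofReal (ψ t) ^ r ∂μ := by
      rw [ofReal_integral_eq_lintegral_ofReal φ.integrable_of_isFiniteMeasure (ae_of_all _ hφ)]
      refine lintegral_congr fun t => ?_
      rw [ENNReal.ofReal_rpow_of_nonneg (hψ t) hr0.le]
      rfl
    rw [← e1, ← ENNReal.ofReal_mul hK.le]
    change Y.nrm (F ψ) ^ r ≤ _
    rw [← ENNReal.ofReal_toReal hFfin.ne, ENNReal.ofReal_rpow_of_nonneg ENNReal.toReal_nonneg hr0.le]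
    exact ENNReal.ofReal_le_ofReal key2
  · rw [lintegral_eq_nnreal]
    refine iSup₂_le fun φ hφ => ?_
    let φ' : SimpleFunc Ω ℝ := φ.map fun a : NNReal => (a : ℝ)
    have hφ' : 0 ≤ φ' := fun t => (φ t).2
    have e1 : (φ.map ENNReal.ofNNReal).lintegral μ = ENNReal.ofReal (∫ t, φ' t ∂μ) := by
      rw [ofReal_integral_eq_lintegral_ofReal φ'.integrable_of_isFiniteMeasure (ae_of_all _ hφ'),
        ← SimpleFunc.lintegral_eq_lintegral]
      refine lintegral_congr fun t => ?_
      simp [φ']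
    rw [e1]
    refine ENNReal.ofReal_le_ofReal ((hμl φ' hφ').trans (hl2 φ' x (ae_of_all _ fun t => ?_)))
    have h1 : (φ t : ℝ) ≤ |T x t| ^ r / |T x₀ t| ^ r := by
      have := hφ t
      rw [← ENNReal.ofReal_coe_nnreal, ENNReal.ofReal_le_ofReal_iff (by positivity)] at this
      exact this
    change (φ t : ℝ) * _ ≤ _
    rcases (abs_nonneg (T x₀ t)).eq_or_lt with h | h
    · rw [← h, Real.zero_rpow hr0.ne', mul_zero]
      positivity
    · rwa [le_div_iff₀ (by positivity)] at h1

/-- A multiplication operator which is bounded on the simple functions is bounded. -/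
theorem BanachFunctionSpace.nrm_le_of_forall_simpleFunc {r : ℝ} (hr : 1 ≤ r)
    (Y : BanachFunctionSpace ν) {w : Ω →ₘ[ν] ℝ} (hw : Y.nrm w < ∞) (hw0 : 0 ≤ w)
    {μ : Measure Ω} {K : ℝ}
    (hK : ∀ ψ : SimpleFunc Ω ℝ, 0 ≤ ψ → Y.nrm (AEEqFun.mk ψ ψ.aestronglyMeasurable * w) ^ r
        ≤ ENNReal.ofReal K * ∫⁻ t, ENNReal.ofReal (ψ t) ^ r ∂μ)
    {g : Ω → ℝ} (hg : Measurable g) (hg0 : 0 ≤ g) (hg1 : ∫⁻ t, ENNReal.ofReal (g t) ^ r ∂μ ≤ 1)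
    {z : Ω →ₘ[ν] ℝ} (hz : ∀ᵐ t ∂ν, z t = g t * w t) :
    Y.nrm z ≤ ENNReal.ofReal K ^ (1 / r) := by
  have hr0 : 0 < r := by linarith
  rw [l0_nonneg_iff] at hw0
  let f : Ω → ℝ≥0∞ := fun t => ENNReal.ofReal (g t)
  have hf : Measurable f := hg.ennreal_ofReal
  let ψ : ℕ → SimpleFunc Ω ℝ := fun n => (SimpleFunc.eapprox f n).map ENNReal.toReal
  have hψ0 : ∀ n, 0 ≤ ψ n := fun n t => ENNReal.toReal_nonneg
  have hψmono : ∀ i j, i ≤ j → ∀ t, ψ i t ≤ ψ j t := fun i j hij t =>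
    ENNReal.toReal_mono (SimpleFunc.eapprox_lt_top f j t).ne (SimpleFunc.monotone_eapprox f hij t)
  have hψlim : ∀ t, Tendsto (fun n => ψ n t) atTop (𝓝 (g t)) := by
    intro t
    have h1 : Tendsto (fun n => SimpleFunc.eapprox f n t) atTop (𝓝 (f t)) := by
      rw [← SimpleFunc.iSup_eapprox_apply hf t]
      exact tendsto_atTop_iSup fun i j hij => SimpleFunc.monotone_eapprox f hij t
    have := (ENNReal.tendsto_toReal ENNReal.ofReal_ne_top).comp h1
    rwa [ENNReal.toReal_ofReal (hg0 t)] at this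
  have hψg : ∀ n t, ψ n t ≤ g t := fun n t =>
    ge_of_tendsto (hψlim t) (by
      filter_upwards [eventually_ge_atTop n] with j hj using hψmono n j hj t)
  let F : SimpleFunc Ω ℝ → (Ω →ₘ[ν] ℝ) := fun ψ => AEEqFun.mk ψ ψ.aestronglyMeasurable * w
  have hF : ∀ ψ, F ψ =ᵐ[ν] fun t => ψ t * w t := by
    intro ψ
    filter_upwards [AEEqFun.coeFn_mul (AEEqFun.mk ψ ψ.aestronglyMeasurable) w,
      AEEqFun.coeFn_mk (μ := ν) ψ ψ.aestronglyMeasurable] with t h1 h2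
    rw [h1, Pi.mul_apply, h2]
  have hroot : ∀ {a b : ℝ≥0∞}, a ^ r ≤ b → a ≤ b ^ (1 / r) := fun {a b} h => by
    rwa [one_div, ENNReal.le_rpow_inv_iff hr0]
  let e : ℕ → ℝ≥0∞ := fun n => ∫⁻ t, ENNReal.ofReal (g t - ψ n t) ^ r ∂μ
  have he : Tendsto (fun n => (ENNReal.ofReal K * e n) ^ (1 / r)) atTop (𝓝 0) := by
    have h1 : Tendsto e atTop (𝓝 0) := by
      have : (0 : ℝ≥0∞) = ∫⁻ t, 0 ∂μ := by simp
      rw [this]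
      refine tendsto_lintegral_of_dominated_convergence (fun t => f t ^ r) (fun n => ?_)
        (fun n => ae_of_all _ fun t => ?_) (hg1.trans_lt ENNReal.one_lt_top).ne
        (ae_of_all _ fun t => ?_)
      · exact ((hg.sub (ψ n).measurable).ennreal_ofReal).pow_const r
      · refine ENNReal.rpow_le_rpow (ENNReal.ofReal_le_ofReal ?_) hr0.le
        exact sub_le_self _ (hψ0 n t)
      · have h2 : Tendsto (fun n => ENNReal.ofReal (g t - ψ n t)) atTop (𝓝 0) := by
          have := ENNReal.tendsto_ofReal ((tendsto_const_nhds (x := g t)).sub (hψlim t))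
          simpa using this
        have := (ENNReal.continuous_rpow_const (y := r)).tendsto 0 |>.comp h2
        simpa [ENNReal.zero_rpow_of_pos hr0, Function.comp_def] using this
    have h2 : Tendsto (fun n => ENNReal.ofReal K * e n) atTop (𝓝 0) := by
      simpa using ENNReal.Tendsto.const_mul h1 (Or.inr ENNReal.ofReal_ne_top)
    have := (ENNReal.continuous_rpow_const (y := 1 / r)).tendsto 0 |>.comp h2
    rwa [ENNReal.zero_rpow_of_pos (one_div_pos.2 hr0)] at this
  -- The bound on simple functions is applied to `ψ j - ψ i ≤ g - ψ i`. By dominated convergence `e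
  -- i` tends to `0`, so `F (ψ n)` is Cauchy in `Y(ν)`.
  have hdiff : ∀ i j, i ≤ j → Y.nrm (F (ψ j) - F (ψ i)) ≤ (ENNReal.ofReal K * e i) ^ (1 / r) := by
    intro i j hij
    have e1 : F (ψ j) - F (ψ i) = F (ψ j - ψ i) := by
      refine AEEqFun.ext ?_
      filter_upwards [AEEqFun.coeFn_sub (F (ψ j)) (F (ψ i)), hF (ψ j), hF (ψ i),
        hF (ψ j - ψ i)] with t h1 h2 h3 h4
      rw [h1, h4, Pi.sub_apply, h2, h3, SimpleFunc.coe_sub, Pi.sub_apply]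
      ring
    rw [e1]
    refine hroot ((hK (ψ j - ψ i) fun t => sub_nonneg.2 (hψmono i j hij t)).trans ?_)
    gcongr ENNReal.ofReal K * ?_
    refine lintegral_mono fun t => ENNReal.rpow_le_rpow (ENNReal.ofReal_le_ofReal ?_) hr0.le
    exact sub_le_sub_right (hψg j t) _
  refine Y.nrm_le_of_cauchy (y := fun n => F (ψ n)) (fun i => Y.nrm_mk_mul_lt_top hw _) ?_ ?_ ?_ ?_ ?_
  · intro i j hij
    filter_upwards [hF (ψ i), hF (ψ j), hw0] with t h1 h2 h3
    rw [h1, h2]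
    exact mul_le_mul_of_nonneg_right (hψmono i j hij t) h3
  · intro ε hε
    obtain ⟨N, hN⟩ := ((tendsto_order.1 he).2 (ε / 2) (ENNReal.half_pos hε.ne')).exists
    refine ⟨N, fun i hi j hj => ?_⟩
    calc Y.nrm (F (ψ i) - F (ψ j))
        = Y.nrm ((F (ψ i) - F (ψ N)) - (F (ψ j) - F (ψ N))) := by rw [sub_sub_sub_cancel_right]
      _ ≤ _ := Y.nrm_sub_le _ _
      _ ≤ ε / 2 + ε / 2 :=
          add_le_add ((hdiff N i hi).trans hN.le) ((hdiff N j hj).trans hN.le)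
      _ = ε := ENNReal.add_halves ε
  · filter_upwards [hz, hw0] with t h1 h2
    rw [h1]
    exact mul_nonneg (hg0 t) h2
  · filter_upwards [hz, ae_all_iff.2 fun n => hF (ψ n)] with t h1 h2
    simp only [h1, h2]
    exact (hψlim t).mul_const _
  · intro i
    refine hroot ((hK _ (hψ0 i)).trans ?_)
    calc _ ≤ ENNReal.ofReal K * ∫⁻ t, ENNReal.ofReal (g t) ^ r ∂μ := by
          gcongr with t
          exact hψg i t
      _ ≤ ENNReal.ofReal K * 1 := by gcongr
      _ = _ := mul_one _

/-- With `u = dμ/dν`, `w = T x₀` and `ω = |w| ^ r / u`, the integral of `|T x| ^ r / ω` against `ν`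
is that of `|T x| ^ r / |w| ^ r` against `μ`. Moreover `ω ^ (1 / r) |y| = g w` with `g = |y| u ^ (-1
/ r)`, and `∫ g ^ r dμ ≤ ∫ |y| ^ r dν`. Where `w` vanishes, so does every `T x`. -/
theorem IsRConvexLattice.weightedInequality [SigmaFinite ν] {r : ℝ} (hr : 1 ≤ r)
    (hE : IsRConvexLattice E r) {Y : BanachFunctionSpace ν} (hY : Y.IsRConcave r)
    {T : E →ₗ[ℝ] (Ω →ₘ[ν] ℝ)} (hTY : Y.IsOperatorInto T) (hT : ∀ x, 0 ≤ x → 0 ≤ T x) :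
    Y.WeightedInequality r T := by
  have hr0 : 0 < r := by linarith
  obtain ⟨x₀, hx₀, hsupp⟩ := exists_nonneg_forall_ae_eq_zero hT
  obtain ⟨K, μ, hμ, hμν, hK, hint⟩ := hE.exists_measure hr hY hTY hT hx₀
  have hwfin : Y.nrm (T x₀) < ∞ := by
    obtain ⟨d, hd, hTY⟩ := hTY
    exact (hTY x₀).trans_lt ENNReal.ofReal_lt_top
  have hw0' := hT x₀ hx₀
  have hw0 := l0_nonneg_iff.1 hw0'
  set w := T x₀ with hw
  have hwm : Measurable w := w.measurable
  let u : Ω → ℝ≥0∞ := μ.rnDeriv ν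
  have hu : Measurable u := Measure.measurable_rnDeriv μ ν
  have hufin : ∀ᵐ t ∂ν, u t < ∞ := Measure.rnDeriv_lt_top μ ν
  have hμu : ∀ f : Ω → ℝ≥0∞, Measurable f → ∫⁻ t, u t * f t ∂ν = ∫⁻ t, f t ∂μ := fun f hf =>
    lintegral_rnDeriv_mul hμν hf.aemeasurable
  -- Without this `ω` would be `0`, by division by zero, at points where `T x` need not vanish. The
  -- set `{u = 0}` is `μ`-null, so the multiplier bound for its indicator forces `w = 0` a.e. on it.
  have hupos : ∀ᵐ t ∂ν, w t ≠ 0 → u t ≠ 0 := by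
    have hB : MeasurableSet {t | u t = 0} := hu (measurableSet_singleton 0)
    let ψ : SimpleFunc Ω ℝ := SimpleFunc.piecewise {t | u t = 0} hB
      (SimpleFunc.const Ω 1) (SimpleFunc.const Ω 0)
    have hψ : ∀ t, ψ t = if u t = 0 then 1 else 0 := fun t => by
      by_cases h : u t = 0 <;> simp [ψ, h]
    have h1 := hK ψ fun t => by
      rw [hψ]; split_ifs <;> simp
    have h2 : ∫⁻ t, ENNReal.ofReal (ψ t) ^ r ∂μ = 0 := by
      rw [← hμu _ (ψ.measurable.ennreal_ofReal.pow_const r)]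
      have : ∀ t, u t * ENNReal.ofReal (ψ t) ^ r = 0 := by
        intro t
        rw [hψ]
        split_ifs with h
        · rw [h, zero_mul]
        · rw [ENNReal.ofReal_zero, ENNReal.zero_rpow_of_pos hr0, mul_zero]
      simp [this]
    rw [h2, mul_zero, nonpos_iff_eq_zero, ENNReal.rpow_eq_zero_iff_of_pos hr0, Y.nrm_eq_zero] at h1
    filter_upwards [AEEqFun.coeFn_mul (AEEqFun.mk ψ ψ.aestronglyMeasurable) w,
      AEEqFun.coeFn_mk (μ := ν) ψ ψ.aestronglyMeasurable,
      AEEqFun.coeFn_zero (β := ℝ) (μ := ν)] with t h3 h4 h5 h6 h7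
    rw [h1, h5, Pi.mul_apply, h4, hψ, if_pos h7, one_mul] at h3
    exact h6 h3.symm
  let ωf : Ω → ℝ := fun t => |w t| ^ r / (u t).toReal
  have hωm : Measurable ωf := ((hwm.abs).pow_const r).div hu.ennreal_toReal
  have hω0 : ∀ t, 0 ≤ ωf t := fun t => by positivity
  let ω : Ω →ₘ[ν] ℝ := AEEqFun.mk ωf hωm.aestronglyMeasurable
  have hω : ω =ᵐ[ν] ωf := AEEqFun.coeFn_mk _ _
  refine ⟨ω, l0_nonneg_iff.2 (by filter_upwards [hω] with t ht; rw [ht]; exact hω0 t), ?_, ?_⟩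
  · refine lt_of_le_of_lt (iSup₂_le fun y hy => ?_)
      (ENNReal.rpow_lt_top_of_nonneg (y := 1 / r) (by positivity) (ENNReal.ofReal_ne_top (r := K)))
    -- Where `u = 0` the inverse of zero makes `g` vanish, and there `ω` vanishes as well.
    let g : Ω → ℝ := fun t => |y t| * ((u t).toReal ^ (1 / r))⁻¹
    have hg : Measurable g :=
      y.measurable.abs.mul ((hu.ennreal_toReal).pow_const _).inv
    have hg0 : 0 ≤ g := fun t => by positivity
    have hy1 : ∫⁻ t, ‖y t‖ₑ ^ r ∂ν ≤ 1 := by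
      rw [eLpNorm_eq_lintegral_rpow_enorm_toReal (by simpa using hr0) ENNReal.ofReal_ne_top,
        ENNReal.toReal_ofReal hr0.le] at hy
      rwa [one_div, ENNReal.rpow_inv_le_iff hr0, ENNReal.one_rpow] at hy
    have hg1 : ∫⁻ t, ENNReal.ofReal (g t) ^ r ∂μ ≤ 1 := by
      rw [← hμu _ (hg.ennreal_ofReal.pow_const r)]
      refine le_trans (lintegral_mono_ae ?_) hy1
      filter_upwards [hufin] with t ht
      rw [Real.enorm_eq_ofReal_abs,
        ENNReal.ofReal_rpow_of_nonneg (hg0 t) hr0.le,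
        ENNReal.ofReal_rpow_of_nonneg (abs_nonneg _) hr0.le]
      nth_rw 1 [← ENNReal.ofReal_toReal ht.ne]
      rw [← ENNReal.ofReal_mul ENNReal.toReal_nonneg]
      refine ENNReal.ofReal_le_ofReal ?_
      have h1 : g t ^ r = |y t| ^ r * ((u t).toReal)⁻¹ := by
        simp only [g]
        rw [Real.mul_rpow (abs_nonneg _) (by positivity), Real.inv_rpow (by positivity),
          ← Real.rpow_mul ENNReal.toReal_nonneg, one_div_mul_cancel hr0.ne', Real.rpow_one]
      rw [h1, mul_left_comm]
      refine mul_le_of_le_one_right (by positivity) ?_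
      exact mul_inv_le_one
    let z : Ω →ₘ[ν] ℝ := AEEqFun.mk (fun t => g t * w t) (hg.mul hwm).aestronglyMeasurable
    have hz : ∀ᵐ t ∂ν, z t = g t * w t := AEEqFun.coeFn_mk _ _
    refine le_trans (Y.nrm_le_of_ae (z := z) ?_)
      (Y.nrm_le_of_forall_simpleFunc hr hwfin hw0' hK hg hg0 hg1 hz)
    filter_upwards [hz, AEEqFun.coeFn_mul (l0Pow ω (1 / r)) y, coeFn_l0Pow ω (1 / r), hω, hw0]
      with t h1 h2 h3 h4 h5
    rw [h1, h2, Pi.mul_apply, h3, h4, abs_mul, abs_mul, abs_of_nonneg (hg0 t),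
      abs_of_nonneg (Real.rpow_nonneg (hω0 t) _)]
    simp only [ωf, g]
    rw [Real.div_rpow (by positivity) ENNReal.toReal_nonneg, ← Real.rpow_mul (abs_nonneg _),
      mul_one_div_cancel hr0.ne', Real.rpow_one]
    apply le_of_eq
    ring
  · intro x
    have h1 : ∫⁻ t, ENNReal.ofReal (|T x t| ^ r) / ENNReal.ofReal (ω t) ∂ν
        ≤ ENNReal.ofReal (‖x‖ ^ r) := by
      refine le_trans (le_of_eq ?_) (hint x)
      have h2 := hμu (fun t => ENNReal.ofReal (|T x t| ^ r / |w t| ^ r)) (((T x).measurable.abs.pow_const r).div (hwm.abs.pow_const r)).ennreal_ofReal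
      rw [← h2]
      refine lintegral_congr_ae ?_
      filter_upwards [hω, hsupp x, hupos, hufin] with t h1 h2 h3 h4
      rw [h1]
      by_cases h5 : w t = 0
      · rw [h2 h5, h5]
        simp [Real.zero_rpow hr0.ne']
      · have h6 : 0 < (u t).toReal := ENNReal.toReal_pos (h3 h5) h4.ne
        have h7 : 0 < |w t| ^ r := Real.rpow_pos_of_pos (abs_pos.2 h5) r
        nth_rw 1 [← ENNReal.ofReal_toReal h4.ne]
        rw [← ENNReal.ofReal_div_of_pos (by positivity), ← ENNReal.ofReal_mul h6.le]
        congr 1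
        simp only [ωf]
        field_simp
    calc _ ≤ (ENNReal.ofReal (‖x‖ ^ r)) ^ (1 / r) := ENNReal.rpow_le_rpow h1 (by positivity)
      _ = ENNReal.ofReal ‖x‖ := by
          rw [ENNReal.ofReal_rpow_of_nonneg (by positivity) (by positivity),
            ← Real.rpow_mul (norm_nonneg _), mul_one_div_cancel hr0.ne', Real.rpow_one]

end FunctionSpace

/-! ### The space `L₁(ν)`, and `r`-convexity from a weighted inequality -/

section FunctionSpace

variable {Ω : Type*} [MeasurableSpace Ω] {ν : Measure Ω}

theorem Lp_isOrderedModule : IsOrderedModule ℝ (Lp ℝ 1 ν) :=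
  IsOrderedModule.of_smul_nonneg fun c hc f hf => by
    rw [← Lp.coeFn_nonneg] at hf ⊢
    filter_upwards [hf, Lp.coeFn_smul c f] with t h1 h2
    rw [h2]
    exact smul_nonneg hc h1

variable (ν) in
/-- The Banach function space `L₁(ν)`. -/
noncomputable def BanachFunctionSpace.L1 [SigmaFinite ν] : BanachFunctionSpace ν where
  nrm y := eLpNorm y 1 ν
  nrm_eq_zero y := by
    rw [eLpNorm_eq_zero_iff y.aestronglyMeasurable one_ne_zero]
    constructor
    · intro h
      exact AEEqFun.ext (h.trans AEEqFun.coeFn_zero.symm)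
    · rintro rfl
      exact AEEqFun.coeFn_zero
  nrm_smul c y := by
    rw [eLpNorm_congr_ae (AEEqFun.coeFn_smul c y), eLpNorm_const_smul, Real.enorm_eq_ofReal_abs]
  nrm_add_le y z := by
    rw [eLpNorm_congr_ae (AEEqFun.coeFn_add y z)]
    exact eLpNorm_add_le y.aestronglyMeasurable z.aestronglyMeasurable le_rfl
  nrm_mono y z h := by
    refine eLpNorm_mono_ae ?_
    filter_upwards [AEEqFun.coeFn_le.2 h, AEEqFun.coeFn_abs y, AEEqFun.coeFn_abs z] with t h1 h2 h3
    rwa [h2, h3] at h1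
  support A hA h := by
    -- Cutting down to finite measure makes the indicator integrable, hence a test function for the
    -- support.
    have key : ∀ n, ν (A ∩ spanningSets ν n) = 0 := by
      intro n
      have hm : MeasurableSet (A ∩ spanningSets ν n) := hA.inter (measurableSet_spanningSets ν n)
      let y : Ω →ₘ[ν] ℝ := AEEqFun.mk ((A ∩ spanningSets ν n).indicator fun _ => (1 : ℝ))
        (aestronglyMeasurable_const.indicator hm)
      have hy : y =ᵐ[ν] (A ∩ spanningSets ν n).indicator fun _ => (1 : ℝ) := AEEqFun.coeFn_mk _ _
      have h1 := h y (by
        rw [eLpNorm_congr_ae hy, eLpNorm_indicator_const hm one_ne_zero ENNReal.one_ne_top]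
        simpa using (measure_mono Set.inter_subset_right).trans_lt
          (measure_spanningSets_lt_top ν n))
      rw [measure_eq_zero_iff_ae_notMem]
      filter_upwards [h1, hy] with t h2 h3 h4
      rw [h2 h4.1, Set.indicator_of_mem h4] at h3
      exact zero_ne_one h3
    have : A = ⋃ n, A ∩ spanningSets ν n := by
      rw [← Set.inter_iUnion, iUnion_spanningSets, Set.inter_univ]
    rw [this]
    exact measure_iUnion_null key
  fatou y z _ hy hmono hlim := by
    simp only [eLpNorm_one_eq_lintegral_enorm]
    have h0 : ∀ᵐ t ∂ν, ∀ i, 0 ≤ y i t := ae_all_iff.2 fun i => l0_nonneg_iff.1 (hy i)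
    have hm : ∀ᵐ t ∂ν, ∀ i, y i t ≤ y (i + 1) t :=
      ae_all_iff.2 fun i => AEEqFun.coeFn_le.2 (hmono (Nat.le_succ i))
    refine lintegral_tendsto_of_tendsto_of_monotone (fun n => (y n).aemeasurable.enorm) ?_ ?_
    · filter_upwards [h0, hm] with t h1 h2
      refine monotone_nat_of_le_succ fun i => ?_
      rw [Real.enorm_of_nonneg (h1 i), Real.enorm_of_nonneg (h1 (i + 1))]
      exact ENNReal.ofReal_le_ofReal (h2 i)
    · filter_upwards [hlim] with t ht
      exact (continuous_enorm.tendsto _).comp ht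
  complete y hy hcau := by
    let Y : ℕ → Lp ℝ 1 ν := fun i => ⟨y i, Lp.mem_Lp_iff_eLpNorm_lt_top.2 (hy i)⟩
    have hdist : ∀ (f g : Lp ℝ 1 ν),
        edist f g = eLpNorm ((f : Ω →ₘ[ν] ℝ) - (g : Ω →ₘ[ν] ℝ) : Ω →ₘ[ν] ℝ) 1 ν := by
      intro f g
      rw [Lp.edist_def]
      exact eLpNorm_congr_ae (AEEqFun.coeFn_sub _ _).symm
    have hY : CauchySeq Y := by
      rw [EMetric.cauchySeq_iff]
      intro ε hε
      rcases eq_or_ne ε ∞ with rfl | hεt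
      · exact ⟨0, fun m _ n _ => edist_lt_top _ _⟩
      obtain ⟨N, hN⟩ := hcau (ε / 2) (ENNReal.half_pos hε.ne')
      refine ⟨N, fun m hm n hn => ?_⟩
      rw [hdist]
      exact (hN m hm n hn).trans_lt (ENNReal.half_lt_self hε.ne' hεt)
    obtain ⟨z, hz⟩ := cauchySeq_tendsto_of_complete hY
    refine ⟨z, Lp.mem_Lp_iff_eLpNorm_lt_top.1 z.2, ?_⟩
    have := tendsto_iff_edist_tendsto_0.1 hz
    simpa only [hdist] using this

/-- Minkowski's inequality by duality: if `a` norms the vector of the `‖y k‖₁` in `ℓ_rⁿ`, then `∑ a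
k * ‖y k‖₁ = ∫ ∑ a k * |y k|`, and the integrand is below `(∑ |y k| ^ r) ^ (1 / r)`. -/
theorem BanachFunctionSpace.L1_isRConcave [SigmaFinite ν] {r : ℝ} (hr : 1 ≤ r) :
    (BanachFunctionSpace.L1 ν).IsRConcave r := by
  have hr0 : 0 < r := by linarith
  refine ⟨1, zero_le_one, fun n y hy => ?_⟩
  rw [ENNReal.ofReal_one, one_mul]
  change ∀ k, eLpNorm (y k) 1 ν < ∞ at hy
  change (∑ k, eLpNorm (y k) 1 ν ^ r) ^ (1 / r) ≤ eLpNorm (l0Sum r y) 1 ν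
  by_cases hfin : eLpNorm (l0Sum r y) 1 ν = ∞
  · rw [hfin]; exact le_top
  have hF : Integrable (l0Sum r y) ν := memLp_one_iff_integrable.1
    ⟨(l0Sum r y).aestronglyMeasurable, lt_top_iff_ne_top.2 hfin⟩
  have hyi : ∀ k, Integrable (y k) ν := fun k => memLp_one_iff_integrable.1
    ⟨(y k).aestronglyMeasurable, hy k⟩
  have hnorm : ∀ f : Ω →ₘ[ν] ℝ, (eLpNorm f 1 ν).toReal = ∫ t, |f t| ∂ν := fun f => by
    rw [eLpNorm_one_eq_lintegral_enorm, ← integral_norm_eq_lintegral_enorm f.aestronglyMeasurable]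
    rfl
  let b : Fin n → ℝ := fun k => (eLpNorm (y k) 1 ν).toReal
  have hb : ∀ k, 0 ≤ b k := fun k => ENNReal.toReal_nonneg
  have e : (∑ k, eLpNorm (y k) 1 ν ^ r) ^ (1 / r) = ENNReal.ofReal ((∑ k, |b k| ^ r) ^ (1 / r)) := by
    rw [← ENNReal.ofReal_rpow_of_nonneg (by positivity) (by positivity),
      ENNReal.ofReal_sum_of_nonneg fun k _ => by positivity]
    congr 1
    refine Finset.sum_congr rfl fun k _ => ?_
    rw [abs_of_nonneg (hb k), ← ENNReal.ofReal_rpow_of_nonneg (hb k) hr0.le,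
      ENNReal.ofReal_toReal (hy k).ne]
  rw [e, ← ENNReal.ofReal_toReal hfin]
  refine ENNReal.ofReal_le_ofReal ?_
  obtain ⟨a, ha, hab⟩ := exists_mem_dualBall_sum_eq hr b
  rw [← hab, hnorm]
  calc ∑ k, a k * b k = ∑ k, ∫ t, a k * |y k t| ∂ν :=
        Finset.sum_congr rfl fun k _ => by rw [integral_const_mul, ← hnorm]
    _ = ∫ t, ∑ k, a k * |y k t| ∂ν :=
        (integral_finsetSum _ fun k _ => (hyi k).abs.const_mul _).symm
    _ ≤ ∫ t, |l0Sum r y t| ∂ν := by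
        refine integral_mono_ae (integrable_finsetSum _ fun k _ => (hyi k).abs.const_mul _) hF.abs ?_
        filter_upwards [coeFn_l0Sum r y] with t ht
        rw [ht]
        refine le_trans ?_ (le_abs_self _)
        simpa using ha fun k => |y k t|

/-- A weighted inequality for `T` implies that `T` is `r`-convex. -/
theorem BanachFunctionSpace.WeightedInequality.exists_nrm_l0Sum_le {Y : BanachFunctionSpace ν}
    {r : ℝ} (hr : 1 ≤ r)
    {X : Type*} [NormedAddCommGroup X] [NormedSpace ℝ X] {T : X →ₗ[ℝ] (Ω →ₘ[ν] ℝ)}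
    (h : Y.WeightedInequality r T) :
    ∃ M : ℝ, ∀ (n : ℕ) (x : Fin n → X),
      Y.nrm (l0Sum r fun k => T (x k)) ≤ ENNReal.ofReal ((∑ k, ‖x k‖ ^ r) ^ (1 / r) * M) := by
  have hr0 : 0 < r := by linarith
  obtain ⟨ω, hω0, hM, hT⟩ := h
  rw [l0_nonneg_iff] at hω0
  set M := ⨆ (y : Ω →ₘ[ν] ℝ) (_ : eLpNorm y (ENNReal.ofReal r) ν ≤ 1), Y.nrm (l0Pow ω (1 / r) * y)
    with hMdef
  refine ⟨M.toReal, fun n x => ?_⟩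
  set B := ∑ k, ‖x k‖ ^ r with hB
  have hB0 : 0 ≤ B := by positivity
  let g : Ω → ℝ := fun t => ∑ k, |T (x k) t| ^ r
  have hg : Measurable g :=
    Finset.measurable_sum _ fun k _ => (T (x k)).measurable.abs.pow_const r
  have hg0 : ∀ t, 0 ≤ g t := fun t => by positivity
  have hint : ∫⁻ t, ENNReal.ofReal (g t) / ENNReal.ofReal (ω t) ∂ν ≤ ENNReal.ofReal B := by
    have e1 : ∀ t, ENNReal.ofReal (g t) / ENNReal.ofReal (ω t)
        = ∑ k, ENNReal.ofReal (|T (x k) t| ^ r) / ENNReal.ofReal (ω t) := by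
      intro t
      simp only [g, div_eq_mul_inv]
      rw [ENNReal.ofReal_sum_of_nonneg fun k _ => by positivity, Finset.sum_mul]
    have hmeas : ∀ k, Measurable fun t => ENNReal.ofReal (|T (x k) t| ^ r) / ENNReal.ofReal (ω t) :=
      fun k => ((T (x k)).measurable.abs.pow_const r).ennreal_ofReal.div
        ω.measurable.ennreal_ofReal
    simp_rw [e1]
    rw [lintegral_finsetSum _ fun k _ => hmeas k, hB, ENNReal.ofReal_sum_of_nonneg fun k _ => by positivity]
    refine Finset.sum_le_sum fun k _ => ?_
    have := hT (x k)
    rw [one_div, ENNReal.rpow_inv_le_iff hr0] at this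
    rwa [← ENNReal.ofReal_rpow_of_nonneg (norm_nonneg _) hr0.le]
  have hdiv : Measurable fun t => ENNReal.ofReal (g t) / ENNReal.ofReal (ω t) :=
    hg.ennreal_ofReal.div ω.measurable.ennreal_ofReal
  -- This uses the convention `s / 0 = ∞`: the integrand is finite a.e.
  have hzero : ∀ᵐ t ∂ν, ω t = 0 → g t = 0 := by
    filter_upwards [ae_lt_top hdiv (hint.trans_lt ENNReal.ofReal_lt_top).ne] with t ht h0
    by_contra hne
    have hpos : 0 < g t := (hg0 t).lt_of_ne (Ne.symm hne)
    rw [h0, ENNReal.ofReal_zero, ENNReal.div_zero (by simpa using hpos)] at ht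
    exact lt_irrefl _ ht
  -- Summing the weighted inequalities bounds the `L_r` norm of `yf` by `B ^ (1 / r)`, while `ω ^ (1
  -- / r) * yf` is the function to be estimated.
  let yf : Ω → ℝ := fun t => (g t / ω t) ^ (1 / r)
  have hyf : Measurable yf := (hg.div ω.measurable).pow_const _
  have hy_int : ∫⁻ t, ‖yf t‖ₑ ^ r ∂ν ≤ ENNReal.ofReal B := by
    refine le_trans (lintegral_mono_ae ?_) hint
    filter_upwards [hω0, hzero] with t h0 h1
    have h2 : 0 ≤ g t / ω t := div_nonneg (hg0 t) h0
    rw [Real.enorm_of_nonneg (Real.rpow_nonneg h2 _),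
      ENNReal.ofReal_rpow_of_nonneg (Real.rpow_nonneg h2 _) hr0.le, ← Real.rpow_mul h2,
      one_div_mul_cancel hr0.ne', Real.rpow_one]
    rcases h0.eq_or_lt with h3 | h3
    · rw [← h3, div_zero, ENNReal.ofReal_zero]
      exact zero_le
    · rw [ENNReal.ofReal_div_of_pos h3]
  -- Normalizing by `s > B ^ (1 / r)` avoids division by `B ^ (1 / r)`, which may be `0`; finally
  -- `s` decreases to it.
  have hbound : ∀ s : ℝ, B ^ (1 / r) < s →
      Y.nrm (l0Sum r fun k => T (x k)) ≤ ENNReal.ofReal (s * M.toReal) := by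
    intro s hs
    have hs0 : 0 < s := lt_of_le_of_lt (by positivity) hs
    let y : Ω →ₘ[ν] ℝ := AEEqFun.mk (fun t => s⁻¹ * yf t) (hyf.const_mul _).aestronglyMeasurable
    have hy : y =ᵐ[ν] fun t => s⁻¹ * yf t := AEEqFun.coeFn_mk _ _
    have hy1 : eLpNorm y (ENNReal.ofReal r) ν ≤ 1 := by
      rw [eLpNorm_congr_ae hy, eLpNorm_eq_lintegral_rpow_enorm_toReal (by simpa using hr0)
        ENNReal.ofReal_ne_top, ENNReal.toReal_ofReal hr0.le, one_div,
        ENNReal.rpow_inv_le_iff hr0, ENNReal.one_rpow]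
      have e1 : ∀ t, ‖s⁻¹ * yf t‖ₑ ^ r = ENNReal.ofReal (s⁻¹ ^ r) * ‖yf t‖ₑ ^ r := fun t => by
        rw [enorm_mul, ENNReal.mul_rpow_of_nonneg _ _ hr0.le, Real.enorm_of_nonneg (by positivity),
          ENNReal.ofReal_rpow_of_nonneg (by positivity) hr0.le]
      simp_rw [e1]
      rw [lintegral_const_mul _ (hyf.enorm.pow_const r)]
      calc _ ≤ ENNReal.ofReal (s⁻¹ ^ r) * ENNReal.ofReal B := by gcongr
        _ = ENNReal.ofReal (s⁻¹ ^ r * B) := (ENNReal.ofReal_mul (by positivity)).symm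
        _ ≤ 1 := by
          rw [ENNReal.ofReal_le_one, Real.inv_rpow hs0.le, inv_mul_le_iff₀ (by positivity), mul_one]
          calc B = (B ^ (1 / r)) ^ r := by
                rw [← Real.rpow_mul hB0, one_div_mul_cancel hr0.ne', Real.rpow_one]
            _ ≤ s ^ r := Real.rpow_le_rpow (by positivity) hs.le hr0.le
    have hyM : Y.nrm (l0Pow ω (1 / r) * y) ≤ M :=
      le_iSup₂ (f := fun (y : Ω →ₘ[ν] ℝ) (_ : eLpNorm y (ENNReal.ofReal r) ν ≤ 1) =>
        Y.nrm (l0Pow ω (1 / r) * y)) y hy1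
    have e2 : Y.nrm (l0Sum r fun k => T (x k)) ≤ Y.nrm (s • (l0Pow ω (1 / r) * y)) := by
      refine Y.nrm_le_of_ae ?_
      filter_upwards [coeFn_l0Sum r fun k => T (x k), AEEqFun.coeFn_smul s (l0Pow ω (1 / r) * y),
        AEEqFun.coeFn_mul (l0Pow ω (1 / r)) y, coeFn_l0Pow ω (1 / r), hy, hω0, hzero]
        with t h1 h2 h3 h4 h5 h6 h7
      rw [h1, h2, Pi.smul_apply, h3, Pi.mul_apply, h4, h5, smul_eq_mul]
      refine le_of_eq (congrArg _ ?_)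
      change g t ^ (1 / r) = _
      rcases h6.eq_or_lt with h8 | h8
      · simp only [yf]
        rw [h7 h8.symm, zero_div, Real.zero_rpow (one_div_pos.2 hr0).ne']
        simp
      · simp only [yf]
        rw [Real.div_rpow (hg0 t) h6]
        have : 0 < ω t ^ (1 / r) := Real.rpow_pos_of_pos h8 _
        field_simp
    refine e2.trans ?_
    rw [Y.nrm_smul, abs_of_pos hs0, ENNReal.ofReal_mul hs0.le, ENNReal.ofReal_toReal hM.ne]
    gcongr
  have hlim : Tendsto (fun s : ℝ => ENNReal.ofReal (s * M.toReal)) (𝓝[>] (B ^ (1 / r)))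
      (𝓝 (ENNReal.ofReal (B ^ (1 / r) * M.toReal))) :=
    (ENNReal.tendsto_ofReal (tendsto_id.mul_const _)).mono_left nhdsWithin_le_nhds
  exact ge_of_tendsto hlim (by filter_upwards [self_mem_nhdsWithin] with s hs using hbound s hs)

end FunctionSpace

/-! ### Failure of `r`-convexity witnessed by positive functionals -/

section BanachLattice

variable {E : Type*} [NormedAddCommGroup E] [Lattice E] [HasSolidNorm E] [IsOrderedAddMonoid E]
  [NormedSpace ℝ E] [IsOrderedModule ℝ E] [CompleteSpace E]

/-- On a Banach lattice which is not `r`-convex there is a positive operator into `ℓ₁` which is not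
`r`-convex. -/
theorem exists_positive_functionals_of_not_isRConvexLattice {r : ℝ}
    (hE : ¬ IsRConvexLattice E r) :
    ∃ (ι : Type) (_ : Countable ι) (τ : ι → (E →ₗ[ℝ] ℝ)), (∀ i x, 0 ≤ x → 0 ≤ τ i x) ∧
      (∀ x, ∑' i, ENNReal.ofReal |τ i x| ≤ ENNReal.ofReal (2 * ‖x‖)) ∧
      ∀ c : ℝ, ∃ (n : ℕ) (x : Fin n → E) (F : Finset ι) (a : ι → Fin n → ℝ),
        (∀ i ∈ F, a i ∈ dualBall r n) ∧
        c * (∑ k, ‖x k‖ ^ r) ^ (1 / r) < ∑ i ∈ F, ∑ k, a i k * τ i (x k) := by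
  classical
  -- The `N`-th block exceeds by the factor `4 ^ N` and enters with weight `2 ^ (-N)`: the weights
  -- are summable and the factor `2 ^ N` is still unbounded.
  have h1 : ∀ N : ℕ, ∃ (n : ℕ) (x : Fin n → E) (F : Finset (Fin n → ℝ))
      (y : {a // a ∈ F} → (E →ₗ[ℝ] ℝ)), (∀ a ∈ F, a ∈ dualBall r n) ∧
      (∀ j x, 0 ≤ x → 0 ≤ y j x) ∧ (∀ x, ∑ j, y j x ≤ ‖x‖) ∧
      4 ^ N * (∑ k, ‖x k‖ ^ r) ^ (1 / r) < ∑ j, y j (∑ k, j.1 k • x k) := by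
    intro N
    have h2 : ∃ (n : ℕ) (x : Fin n → E),
        4 ^ N * (∑ k, ‖x k‖ ^ r) ^ (1 / r) < ‖latticeSum r x‖ := by
      by_contra! hcon
      exact hE ⟨4 ^ N, by positivity, hcon⟩
    obtain ⟨n, x, hx⟩ := h2
    obtain ⟨F, hF, h0F, hFd, hFz⟩ := exists_finset_norm_latticeSum_sub_lt r x (sub_pos.2 hx)
    have : Nonempty {a // a ∈ F} := ⟨⟨0, h0F⟩⟩
    obtain ⟨y, hy0, hy1, hy2⟩ := exists_positive_functionals_norm_sup'
      (fun j : {a // a ∈ F} => ∑ k, j.1 k • x k)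
    refine ⟨n, x, F, y, hFd, hy0, hy1, ?_⟩
    rw [hy2]
    have h3 : ‖F.sup' hF fun a => ∑ k, a k • x k‖
        ≤ ‖(Finset.univ.sup' Finset.univ_nonempty
          (fun j : {a // a ∈ F} => ∑ k, j.1 k • x k))⁺‖ := by
      refine norm_le_norm_of_nonneg_of_le ?_ (Finset.sup'_le _ _ fun a ha => ?_)
      · have := Finset.le_sup' (f := fun a : Fin n → ℝ => ∑ k, a k • x k) h0F
        simpa using this
      · exact (Finset.le_sup' (fun j : {a // a ∈ F} => ∑ k, j.1 k • x k)
          (Finset.mem_univ ⟨a, ha⟩)).trans (le_posPart _)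
    have h4 := norm_sub_norm_le (latticeSum r x) (F.sup' hF fun a => ∑ k, a k • x k)
    linarith
  choose n x F y hFd hy0 hy1 hy2 using h1
  refine ⟨Σ N, {a // a ∈ F N}, inferInstance, fun i => ((1 : ℝ) / 2) ^ i.1 • y i.1 i.2,
    fun i z hz => ?_, fun z => ?_, fun c => ?_⟩
  · exact mul_nonneg (by positivity) (hy0 _ _ _ hz)
  · have habs : ∀ N j, |y N j z| ≤ y N j |z| := by
      intro N j
      rw [abs_le']
      constructor
      · have := hy0 N j _ (sub_nonneg.2 (le_abs_self z))
        rw [map_sub] at this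
        linarith
      · have := hy0 N j _ (sub_nonneg.2 (neg_le_abs z))
        rw [map_sub, map_neg] at this
        linarith
    rw [ENNReal.tsum_sigma']
    calc _ ≤ ∑' N : ℕ, ENNReal.ofReal ((1 / 2) ^ N * ‖z‖) := by
          refine ENNReal.tsum_le_tsum fun N => ?_
          rw [tsum_fintype, ← ENNReal.ofReal_sum_of_nonneg fun _ _ => abs_nonneg _]
          refine ENNReal.ofReal_le_ofReal ?_
          simp only [LinearMap.smul_apply, smul_eq_mul, abs_mul, abs_pow]
          rw [← Finset.mul_sum, abs_of_pos (by norm_num : (0 : ℝ) < 1 / 2)]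
          gcongr
          refine (Finset.sum_le_sum fun j _ => habs N j).trans ((hy1 N |z|).trans_eq ?_)
          exact norm_abs_eq_norm z
      _ = ENNReal.ofReal (∑' N : ℕ, (1 / 2) ^ N * ‖z‖) :=
          (ENNReal.ofReal_tsum_of_nonneg (fun N => by positivity)
            (summable_geometric_two.mul_right _)).symm
      _ ≤ _ := by rw [tsum_mul_right, tsum_geometric_two]
  · obtain ⟨N, hN⟩ := pow_unbounded_of_one_lt c one_lt_two
    -- Only block `N` is tested, each functional with its own coefficient vector; `0` elsewhere is a
    -- mere default.
    let A : (i : Σ N, {a // a ∈ F N}) → Fin (n N) → ℝ := fun i =>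
      if h : i.1 = N then h ▸ i.2.1 else 0
    have hA : ∀ j, A ⟨N, j⟩ = j.1 := fun j => by simp [A]
    refine ⟨n N, x N, Finset.univ.map (Function.Embedding.sigmaMk N), A, ?_, ?_⟩
    · intro i hi
      obtain ⟨j, -, rfl⟩ := Finset.mem_map.1 hi
      simp only [Function.Embedding.sigmaMk_apply, hA]
      exact hFd N _ j.2
    · rw [Finset.sum_map]
      simp only [Function.Embedding.sigmaMk_apply, hA, LinearMap.smul_apply, smul_eq_mul]
      have e : ∑ j : {a // a ∈ F N}, ∑ k, j.1 k * ((1 / 2) ^ N * y N j (x N k))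
          = (1 / 2) ^ N * ∑ j, y N j (∑ k, j.1 k • x N k) := by
        rw [Finset.mul_sum]
        refine Finset.sum_congr rfl fun j _ => ?_
        rw [map_sum, Finset.mul_sum]
        refine Finset.sum_congr rfl fun k _ => ?_
        rw [map_smul, smul_eq_mul]
        ring
      refine lt_of_lt_of_eq ?_ e.symm
      have hS : 0 ≤ (∑ k, ‖x N k‖ ^ r) ^ (1 / r) := by positivity
      calc c * (∑ k, ‖x N k‖ ^ r) ^ (1 / r) ≤ 2 ^ N * (∑ k, ‖x N k‖ ^ r) ^ (1 / r) := by gcongr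
        _ = (1 / 2) ^ N * (4 ^ N * (∑ k, ‖x N k‖ ^ r) ^ (1 / r)) := by
            rw [← mul_assoc, ← mul_pow]; norm_num
        _ < _ := by gcongr; exact hy2 N

end BanachLattice

/-! ### Operators into functions on a discrete space with counting measure -/

section Counting

variable {X : Type*} [NormedAddCommGroup X] [NormedSpace ℝ X] {Ω : Type*} [MeasurableSpace Ω]
  [DiscreteMeasurableSpace Ω]

/-- The linear map into functions on a discrete space given by a family of linear functionals. -/
noncomputable def l0OfFunctionals (τ : Ω → (X →ₗ[ℝ] ℝ)) :
    X →ₗ[ℝ] (Ω →ₘ[Measure.count] ℝ) where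
  toFun x := AEEqFun.mk (fun t => τ t x) (Measurable.of_discrete.aestronglyMeasurable)
  map_add' x y := by
    rw [AEEqFun.mk_add_mk _ _ Measurable.of_discrete.aestronglyMeasurable
      Measurable.of_discrete.aestronglyMeasurable]
    congr 1
    ext t
    simp
  map_smul' c x := by
    rw [RingHom.id_apply, AEEqFun.smul_mk]
    congr 1
    ext t
    simp

/-- Counting measure has no nonempty null sets, so classes can be evaluated at points. -/
theorem l0OfFunctionals_apply (τ : Ω → (X →ₗ[ℝ] ℝ)) (x : X) (t : Ω) :
    l0OfFunctionals τ x t = τ t x :=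
  Measure.ae_count_iff.1 (AEEqFun.coeFn_mk _ Measurable.of_discrete.aestronglyMeasurable) t

theorem l0OfFunctionals_nonneg [Preorder X] {τ : Ω → (X →ₗ[ℝ] ℝ)}
    (hτ : ∀ t x, 0 ≤ x → 0 ≤ τ t x) {x : X} (hx : 0 ≤ x) : 0 ≤ l0OfFunctionals τ x := by
  rw [l0_nonneg_iff, Measure.ae_count_iff]
  intro t
  rw [l0OfFunctionals_apply]
  exact hτ t x hx

theorem eLpNorm_l0OfFunctionals (τ : Ω → (X →ₗ[ℝ] ℝ)) (x : X) :
    eLpNorm (l0OfFunctionals τ x) 1 Measure.count = ∑' t, ENNReal.ofReal |τ t x| := by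
  rw [eLpNorm_one_eq_lintegral_enorm, lintegral_count]
  simp only [l0OfFunctionals_apply, Real.enorm_eq_ofReal_abs]

theorem ofReal_sum_le_eLpNorm_count {f : Ω → ℝ} (F : Finset Ω) {b : Ω → ℝ}
    (hb : ∀ t ∈ F, b t ≤ f t) :
    ENNReal.ofReal (∑ t ∈ F, b t) ≤ eLpNorm f 1 Measure.count := by
  rw [eLpNorm_one_eq_lintegral_enorm, lintegral_count]
  refine le_trans ?_ (ENNReal.sum_le_tsum F)
  calc ENNReal.ofReal (∑ t ∈ F, b t) ≤ ENNReal.ofReal (∑ t ∈ F, |f t|) :=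
        ENNReal.ofReal_le_ofReal (Finset.sum_le_sum fun t ht => (hb t ht).trans (le_abs_self _))
    _ = ∑ t ∈ F, ENNReal.ofReal |f t| := ENNReal.ofReal_sum_of_nonneg fun _ _ => abs_nonneg _
    _ ≤ _ := le_of_eq (Finset.sum_congr rfl fun t _ => (Real.enorm_eq_ofReal_abs _).symm)

end Counting

/-! ### Operators into `ℓ₁` that violate (2) and (3) -/

section Converse

variable {E : Type u} [NormedAddCommGroup E] [Lattice E] [HasSolidNorm E] [IsOrderedAddMonoid E]
  [NormedSpace ℝ E] [IsOrderedModule ℝ E] [CompleteSpace E]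

/-- A version of `exists_positive_functionals_of_not_isRConvexLattice` with an index set, which is
a discrete measurable space, in a given universe. -/
theorem exists_discrete_functionals_of_not_isRConvexLattice {r : ℝ}
    (hE : ¬ IsRConvexLattice E r) :
    ∃ (Ω : Type w) (_ : MeasurableSpace Ω) (_ : DiscreteMeasurableSpace Ω) (_ : Countable Ω)
      (τ : Ω → (E →ₗ[ℝ] ℝ)), (∀ t x, 0 ≤ x → 0 ≤ τ t x) ∧
      (∀ x, eLpNorm (l0OfFunctionals τ x) 1 Measure.count ≤ ENNReal.ofReal (2 * ‖x‖)) ∧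
      ∀ c : ℝ, ∃ (n : ℕ) (x : Fin n → E),
        ∀ f : Ω → ℝ, (∀ a ∈ dualBall r n, ∀ t, ∑ k, a k * τ t (x k) ≤ f t) →
          ENNReal.ofReal (c * (∑ k, ‖x k‖ ^ r) ^ (1 / r)) < eLpNorm f 1 Measure.count := by
  obtain ⟨ι, hι, τ, hτ0, hτ1, hτ2⟩ := exists_positive_functionals_of_not_isRConvexLattice hE
  let mΩ : MeasurableSpace (ULift.{w} ι) := ⊤
  have hd : DiscreteMeasurableSpace (ULift.{w} ι) := ⟨fun _ => trivial⟩
  refine ⟨ULift.{w} ι, mΩ, hd, inferInstance, fun t => τ t.down, fun t x hx => hτ0 _ x hx,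
    fun x => ?_, fun c => ?_⟩
  · rw [eLpNorm_l0OfFunctionals, ← Equiv.ulift.symm.tsum_eq]
    exact hτ1 x
  -- Passing to `max c 0` makes the larger sum positive, as strict monotonicity of `ENNReal.ofReal`
  -- requires.
  · obtain ⟨n, x, F, a, ha, hlt⟩ := hτ2 (max c 0)
    refine ⟨n, x, fun f hf => ?_⟩
    have hS : 0 ≤ (∑ k, ‖x k‖ ^ r) ^ (1 / r) := by positivity
    refine lt_of_lt_of_le ?_ (ofReal_sum_le_eLpNorm_count (F.map Equiv.ulift.symm.toEmbedding)
      (b := fun t => ∑ k, a t.down k * τ t.down (x k)) ?_)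
    · rw [Finset.sum_map]
      have h0 := mul_nonneg (le_max_right c 0) hS
      refine (ENNReal.ofReal_lt_ofReal_iff (h0.trans_lt hlt)).2 (lt_of_le_of_lt ?_ hlt)
      exact mul_le_mul_of_nonneg_right (le_max_left c 0) hS
    · intro t ht
      obtain ⟨i, hi, rfl⟩ := Finset.mem_map.1 ht
      exact hf _ (ha i hi) _

/-- The lattice sum formed in `ℓ₁` need not be computed: being an upper bound, it dominates every `∑
a k * τ t (x k)` pointwise, and that already makes its norm too large. -/
theorem isRConvexLattice_of_forall_isRConvexOperator {r : ℝ}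
    (h : ∀ (Y : Type v) [NormedAddCommGroup Y] [Lattice Y] [HasSolidNorm Y] [IsOrderedAddMonoid Y]
        [NormedSpace ℝ Y] [IsOrderedModule ℝ Y] [CompleteSpace Y] (T : E →L[ℝ] Y),
        (∀ x, 0 ≤ x → 0 ≤ T x) → IsRConvexOperator r T) : IsRConvexLattice E r := by
  by_contra hE
  obtain ⟨Ω, _, _, _, τ, hτ0, hτ1, hτ2⟩ :=
    exists_discrete_functionals_of_not_isRConvexLattice.{u, v} hE
  have : IsOrderedModule ℝ (Lp ℝ 1 (Measure.count : Measure Ω)) := Lp_isOrderedModule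
  let T₀ : E →ₗ[ℝ] Lp ℝ 1 (Measure.count : Measure Ω) :=
    { toFun := fun x => ⟨l0OfFunctionals τ x, Lp.mem_Lp_iff_eLpNorm_lt_top.2
        ((hτ1 x).trans_lt ENNReal.ofReal_lt_top)⟩
      map_add' := fun x y => Subtype.ext (map_add (l0OfFunctionals τ) x y)
      map_smul' := fun c x => Subtype.ext (map_smul (l0OfFunctionals τ) c x) }
  have hT₀ : ∀ x t, T₀ x t = τ t x := fun x t => l0OfFunctionals_apply τ x t
  let T : E →L[ℝ] Lp ℝ 1 (Measure.count : Measure Ω) := T₀.mkContinuous 2 fun x => by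
    rw [Lp.norm_def]
    exact ENNReal.toReal_le_of_le_ofReal (by positivity) (hτ1 x)
  obtain ⟨c, hc, hT⟩ := h _ T fun x hx => by
    rw [← Lp.coeFn_nonneg]
    exact Measure.ae_count_iff.2 fun t => (hτ0 t x hx).trans_eq (hT₀ x t).symm
  obtain ⟨n, x, hx⟩ := hτ2 c
  let f : Lp ℝ 1 (Measure.count : Measure Ω) := latticeSum r fun k => T (x k)
  refine absurd (hx f fun a ha t => ?_) (not_lt.2 ?_)
  · have h1 := Measure.ae_count_iff.1
      (Lp.coeFn_le _ _ |>.2 (sum_smul_le_latticeSum ha fun k => T (x k))) t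
    refine le_trans (le_of_eq ?_) h1
    have h2 : ∑ k, a k • T (x k) = T (∑ k, a k • x k) := by simp
    rw [h2]
    exact (by simp : ∑ k, a k * τ t (x k) = τ t (∑ k, a k • x k)).trans (hT₀ _ t).symm
  · have := hT n x
    rw [Lp.norm_def] at this
    exact (ENNReal.le_ofReal_iff_toReal_le (Lp.eLpNorm_ne_top _) (by positivity)).2 this

/-- The same functionals, now read as an operator into the `r`-concave function space `ℓ₁`; a weight
would bound the pointwise sums, which dominate every `∑ a k * τ t (x k)` by the definition of the
dual ball. -/
theorem isRConvexLattice_of_forall_weightedInequality {r : ℝ} (hr : 1 ≤ r)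
    (h : ∀ (Ω : Type w) [MeasurableSpace Ω] (ν : Measure Ω) [SigmaFinite ν] [ν.IsComplete]
        (Y : BanachFunctionSpace ν), Y.IsRConcave r →
        ∀ T : E →ₗ[ℝ] (Ω →ₘ[ν] ℝ), Y.IsOperatorInto T → (∀ x, 0 ≤ x → 0 ≤ T x) →
          Y.WeightedInequality r T) : IsRConvexLattice E r := by
  by_contra hE
  obtain ⟨Ω, _, _, _, τ, hτ0, hτ1, hτ2⟩ :=
    exists_discrete_functionals_of_not_isRConvexLattice.{u, w} hE
  have : (Measure.count : Measure Ω).IsComplete := ⟨fun s _ => MeasurableSet.of_discrete⟩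
  obtain ⟨M, hM⟩ := (h Ω Measure.count (BanachFunctionSpace.L1 _)
    (BanachFunctionSpace.L1_isRConcave hr) (l0OfFunctionals τ) ⟨2, zero_le_two, hτ1⟩
    fun x hx => l0OfFunctionals_nonneg hτ0 hx).exists_nrm_l0Sum_le hr
  obtain ⟨n, x, hx⟩ := hτ2 M
  refine absurd (hx (l0Sum r fun k => l0OfFunctionals τ (x k)) fun a ha t => ?_) (not_lt.2 ?_)
  · rw [Measure.ae_count_iff.1 (coeFn_l0Sum r _) t]
    simp only [l0OfFunctionals_apply]
    exact ha _
  · rw [mul_comm]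
    exact hM n x

end Converse

theorem corollary4 (r : ℝ) (hr : 1 ≤ r) (E : Type u) [NormedAddCommGroup E] [Lattice E]
    [HasSolidNorm E] [IsOrderedAddMonoid E] [NormedSpace ℝ E] [IsOrderedModule ℝ E]
    [CompleteSpace E] :
    List.TFAE [
      IsRConvexLattice E r,
      ∀ (Y : Type v) [NormedAddCommGroup Y] [Lattice Y] [HasSolidNorm Y] [IsOrderedAddMonoid Y]
        [NormedSpace ℝ Y] [IsOrderedModule ℝ Y] [CompleteSpace Y] (T : E →L[ℝ] Y),
        (∀ x, 0 ≤ x → 0 ≤ T x) → IsRConvexOperator r T,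
      ∀ (Ω : Type w) [MeasurableSpace Ω] (ν : Measure Ω) [SigmaFinite ν] [ν.IsComplete]
        (Y : BanachFunctionSpace ν), Y.IsRConcave r →
        ∀ T : E →ₗ[ℝ] (Ω →ₘ[ν] ℝ), Y.IsOperatorInto T → (∀ x, 0 ≤ x → 0 ≤ T x) →
          Y.WeightedInequality r T] := by
  tfae_have 1 → 2 := fun h Y _ _ _ _ _ _ _ T hT => h.isRConvexOperator T hT
  tfae_have 2 → 1 := fun h => isRConvexLattice_of_forall_isRConvexOperator h
  tfae_have 1 → 3 := fun h Ω _ ν _ _ Y hY T hTY hT => h.weightedInequality hr hY hTY hT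
  tfae_have 3 → 1 := fun h => isRConvexLattice_of_forall_weightedInequality hr h
  tfae_finish
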